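/- **Conventions.** Let $\mathcal D=C_c^\infty(\mathbb R)$ be the space of complex-valued test functions, $\mathcal D'$ its continuous dual (the distributions on $\mathbb R$), $\mathcal S$ the Schwartz space of $\mathbb R$, and $\mathcal S'$ the space of tempered distributions. The group $\mathbb Z$ acts on $\mathcal D'$ and on $\mathcal S'$ by translation, $(k\cdot T)(x)=T(x+k)$, i.e. $\langle k\cdot T\mid f\rangle=\langle T\mid f(\cdot-k)\rangle$. Let $I$ be the augmentation ideal of the group algebra $\mathbb C[\mathbb Z]$. For a $\mathbb C[\mathbb Z]$-module $V$ and an integer $q\ge 0$ put $$H_q^0(\mathbb Z,V)=\{v\in V: I^{q+1}v=0\},\qquad H_\infty^0(\mathbb Z,V)=\bigcup_{q\ge 0}H_q^0(\mathbb Z,V).$$ For $f\in\mathcal S$ let $\mathcal F(f)(x)=\int_{\mathbb R}f(y)e^{-2\pi ixy}\,dy$, and for $T\in\mathcal S'$ define $\mathcal F(T)\in\mathcal S'$ by $\langle\mathcal F(T)\mid f\rangle=\langle T\mid\mathcal F^{-1}(f)\rangle$. Let $\mathcal S'_{\mathbb Z}$ be the space of tempered distributions supported in $\mathbb Z\subset\mathbb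 R$, and for $q\ge0$ let $O^q\mathcal S'_{\mathbb Z}$ be the space of those $T\in\mathcal S'_{\mathbb Z}$ that can be written, as distributions, in the form $T=\sum_{k\in\mathbb Z}\sum_{n=0}^{q}a_{k,n}\,\partial^n\delta_k$ with $a_{k,n}\in\mathbb C$, where $\delta_k$ is the Dirac distribution at $k$. **Theorem 2.3.** 1. The restriction map $\mathcal S'\to\mathcal D'$ is injective and, regarding $\mathcal S'$ as a subspace of $\mathcal D'$, one has $H_q^0(\mathbb Z,\mathcal D')=H_q^0(\mathbb Z,\mathcal S')$ for every integer $q\ge 0$. In particular, every higher order $\mathbb Z$-invariant distribution is tempered. 2. The Fourier transform restricts to a linear bijection $\mathcal F:H_\infty^0(\mathbb Z,\mathcal S')\to\mathcal S'_{\mathbb Z}$. 3. For every integer $q\ge 0$, $\mathcal F\bigl(H_q^0(\mathbb Z,\mathcal S')\bigr)=O^q\mathcal S'_{\mathbb Z}$. -/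

import Mathlib

open scoped SchwartzMap Distributions ContDiff

noncomputable section

namespace HigherOrder

/-! ### Higher order invariants of a group representation -/

section Invariants

/-- The augmentation ideal of the group algebra `R[Γ]`: the kernel of the algebra homomorphism
`R[Γ] → R` that sends every group element to `1`. -/
def augmentationIdeal (R Γ : Type*) [CommRing R] [Group Γ] : Ideal (MonoidAlgebra R Γ) :=
  RingHom.ker (MonoidAlgebra.lift R R Γ (1 : Γ →* R))

/-- The space `H_q^0(Γ, V)` of invariants of order `q`: all `v ∈ V` with `I ^ (q + 1) v = 0`,
where `I` is the augmentation ideal of the group algebra. -/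
def invariants {R Γ V : Type*} [CommRing R] [Group Γ] [AddCommGroup V] [Module R V]
    (ρ : Representation R Γ V) (q : ℕ) : Submodule R V where
  carrier := {v | ∀ a ∈ augmentationIdeal R Γ ^ (q + 1), ρ.asAlgebraHom a v = 0}
  add_mem' hv hw a ha := by rw [map_add, hv a ha, hw a ha, add_zero]
  zero_mem' a _ := map_zero _
  smul_mem' c v hv a ha := by rw [map_smul, hv a ha, smul_zero]

theorem invariants_mono {R Γ V : Type*} [CommRing R] [Group Γ] [AddCommGroup V] [Module R V]
    (ρ : Representation R Γ V) : Monotone (invariants ρ) :=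
  fun _ _ h _ hv a ha => hv a (Ideal.pow_le_pow_right (Nat.succ_le_succ h) ha)

/-- The space `H_∞^0(Γ, V)` of higher order invariants: the union of all `H_q^0(Γ, V)`. -/
def invariantsTop {R Γ V : Type*} [CommRing R] [Group Γ] [AddCommGroup V] [Module R V]
    (ρ : Representation R Γ V) : Submodule R V where
  carrier := ⋃ q : ℕ, (invariants ρ q : Set V)
  add_mem' {v w} hv hw := by
    obtain ⟨i, hi⟩ := Set.mem_iUnion.1 hv
    obtain ⟨j, hj⟩ := Set.mem_iUnion.1 hw
    exact Set.mem_iUnion.2 ⟨max i j, (invariants ρ _).add_mem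
      (invariants_mono ρ (le_max_left i j) hi) (invariants_mono ρ (le_max_right i j) hj)⟩
  zero_mem' := Set.mem_iUnion.2 ⟨0, (invariants ρ 0).zero_mem⟩
  smul_mem' c v hv := by
    obtain ⟨i, hi⟩ := Set.mem_iUnion.1 hv
    exact Set.mem_iUnion.2 ⟨i, (invariants ρ i).smul_mem c hi⟩

end Invariants

/-! ### Test functions and distributions on the real line -/

/-- The space `𝓓 = C_c^∞(ℝ)` of complex valued test functions, with its LF topology. -/
abbrev Test : Type := 𝓓((⊤ : TopologicalSpace.Opens ℝ), ℂ)

/-- The space `𝓓'` of distributions: the continuous `ℂ`-linear functionals on `C_c^∞(ℝ)`. -/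
abbrev Distr : Type := Test →L[ℂ] ℂ

/-- The space `𝓢'` of tempered distributions: the continuous `ℂ`-linear functionals on `𝓢`. -/
abbrev Temp : Type := 𝓢'(ℝ, ℂ)

/-- Translation of test functions supported in `K`, as functions supported in `K + a`. -/
def translateSupportedIn (a : ℝ) (K : TopologicalSpace.Compacts ℝ) :
    𝓓_{K}(ℝ, ℂ) →L[ℂ] 𝓓_{K.map (fun x => x + a) (by fun_prop)}(ℝ, ℂ) :=
  ContDiffMapSupportedIn.mkCLM ℂ (fun f x => f (x - a)) (fun _ _ _ => rfl) (fun _ _ _ => rfl)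
    (fun f => f.contDiff.comp (contDiff_id.sub contDiff_const))
    (fun f x hx => f.zero_on_compl fun h => hx ⟨x - a, h, sub_add_cancel x a⟩)
    (fun i _ => ⟨{i}, 1, zero_le_one, fun f x _ => by
      rw [iteratedFDeriv_comp_sub, Finset.sup_singleton, one_mul]
      exact ContDiffMapSupportedIn.norm_iteratedFDeriv_apply_le_seminorm_top ℂ⟩)

/-- Translation of test functions: `(translateTest a f) x = f (x - a)`. -/
def translateTest (a : ℝ) : Test →L[ℂ] Test :=
  TestFunction.limitCLM ℂ
    (fun f => ⟨fun x => f (x - a), f.contDiff.comp (contDiff_id.sub contDiff_const),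
      f.hasCompactSupport.comp_homeomorph (Homeomorph.subRight a), Set.subset_univ _⟩)
    (fun K _ => TestFunction.ofSupportedInCLM ℂ (Set.subset_univ _) ∘L translateSupportedIn a K)
    (fun _ _ _ => rfl)

@[simp]
theorem translateTest_apply (a : ℝ) (f : Test) (x : ℝ) : translateTest a f x = f (x - a) := rfl

/-- The translation action of `ℤ` on distributions, `(k T)(x) = T(x + k)`, that is
`⟨k T | f⟩ = ⟨T | f(· - k)⟩`. -/
def translateDistr : Representation ℂ (Multiplicative ℤ) Distr where
  toFun k :=
    { toFun := fun T => T ∘L translateTest (k.toAdd : ℝ)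
      map_add' := fun _ _ => rfl
      map_smul' := fun _ _ => rfl }
  map_one' := by
    refine LinearMap.ext fun T => ContinuousLinearMap.ext fun f => ?_
    exact congrArg T (TestFunction.ext fun x => by simp)
  map_mul' k l := by
    refine LinearMap.ext fun T => ContinuousLinearMap.ext fun f => ?_
    exact congrArg T (TestFunction.ext fun x => by simp [sub_sub, add_comm])

/-- The translation action of `ℤ` on tempered distributions, `(k T)(x) = T(x + k)`, that is
`⟨k T | f⟩ = ⟨T | f(· - k)⟩`. -/
def translateTemp : Representation ℂ (Multiplicative ℤ) Temp where
  toFun k := (PointwiseConvergenceCLM.precomp ℂ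
    (SchwartzMap.compSubConstCLM ℂ (k.toAdd : ℝ) : 𝓢(ℝ, ℂ) →L[ℂ] 𝓢(ℝ, ℂ))).toLinearMap
  map_one' := by
    refine LinearMap.ext fun T => ContinuousLinearMap.ext fun f => ?_
    exact congrArg T (SchwartzMap.ext fun x => by simp)
  map_mul' k l := by
    refine LinearMap.ext fun T => ContinuousLinearMap.ext fun f => ?_
    exact congrArg T (SchwartzMap.ext fun x => by simp)

/-- The continuous inclusion of the smooth functions supported in `K` into `𝓢`. -/
def supportedInToSchwartz (K : TopologicalSpace.Compacts ℝ) : 𝓓_{K}(ℝ, ℂ) →L[ℂ] 𝓢(ℝ, ℂ) where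
  toFun f := f.hasCompactSupport.toSchwartzMap f.contDiff
  map_add' _ _ := rfl
  map_smul' _ _ := rfl
  cont := by
    let Φ : 𝓓_{K}(ℝ, ℂ) →ₗ[ℂ] 𝓢(ℝ, ℂ) :=
      { toFun := fun f => f.hasCompactSupport.toSchwartzMap f.contDiff
        map_add' := fun _ _ => rfl
        map_smul' := fun _ _ => rfl }
    change Continuous Φ
    obtain ⟨r, hr⟩ := K.isCompact.isBounded.exists_norm_le
    refine WithSeminorms.continuous_of_isBounded
      (ContDiffMapSupportedIn.withSeminorms ℂ ℝ ℂ ⊤ K) (schwartz_withSeminorms ℂ ℝ ℂ) _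
      (.of_real fun n => ⟨{n.2}, |r| ^ n.1, fun f => ?_⟩)
    rw [Finset.sup_singleton]
    refine SchwartzMap.seminorm_le_bound ℂ n.1 n.2 (Φ f) (by positivity) fun x => ?_
    change ‖x‖ ^ n.1 * ‖iteratedFDeriv ℝ n.2 f x‖ ≤ _
    by_cases hx : x ∈ K
    · have h1 : ‖x‖ ≤ |r| := (hr x hx).trans (le_abs_self r)
      have h2 := ContDiffMapSupportedIn.norm_iteratedFDeriv_apply_le_seminorm_top ℂ
        (i := n.2) (f := f) (x := x)
      change _ ≤ |r| ^ n.1 * _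
      gcongr
    · rw [f.iteratedFDeriv_zero_on_compl hx]
      simp only [Pi.zero_apply, norm_zero, mul_zero]
      exact mul_nonneg (by positivity) (apply_nonneg _ _)

/-- The continuous inclusion `C_c^∞(ℝ) → 𝓢`. -/
def testToSchwartz : Test →L[ℂ] 𝓢(ℝ, ℂ) :=
  TestFunction.limitCLM ℂ (fun f => f.hasCompactSupport.toSchwartzMap f.contDiff)
    (fun K _ => supportedInToSchwartz K) (fun _ _ _ => rfl)

@[simp]
theorem testToSchwartz_apply (f : Test) (x : ℝ) : testToSchwartz f x = f x := rfl

/-- The canonical map `𝓢' → 𝓓'`, restriction of a tempered distribution to test functions. -/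
def tempToDistr : Temp →ₗ[ℂ] Distr where
  toFun T := ContinuousLinearMap.comp (T : 𝓢(ℝ, ℂ) →L[ℂ] ℂ) testToSchwartz
  map_add' _ _ := rfl
  map_smul' _ _ := rfl

@[simp]
theorem tempToDistr_apply (T : Temp) (f : Test) : tempToDistr T f = T (testToSchwartz f) := rfl

/-- The Fourier transform on tempered distributions, with the convention
`⟨𝓕 T | f⟩ = ⟨T | 𝓕⁻¹ f⟩`, where `(𝓕 f)(x) = ∫ f(y) exp(-2πixy) dy` on Schwartz functions. -/
def fourierTemp : Temp →ₗ[ℂ] Temp :=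
  (PointwiseConvergenceCLM.precomp ℂ
    (FourierTransform.fourierInvCLM ℂ 𝓢(ℝ, ℂ))).toLinearMap

/-! ### Supports and the order filtration -/

/-- The integers as a subset of the real line. -/
abbrev intSet : Set ℝ := Set.range ((↑) : ℤ → ℝ)

/-- For a closed set `S`, the space `𝓓'_S` of distributions supported in `S`, that is, those that
vanish on all test functions whose support lies in the open set `Sᶜ`. -/
def distrSupportedIn (S : Set ℝ) : Submodule ℂ Distr where
  carrier := {T | Distribution.IsVanishingOn T Sᶜ}
  add_mem' {T U} hT hU f hf := by
    change T f + U f = 0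
    rw [hT f hf, hU f hf, add_zero]
  zero_mem' _ _ := rfl
  smul_mem' c T hT f hf := by
    change c • T f = 0
    rw [hT f hf, smul_zero]

/-- The space `𝓢'_ℤ = 𝓓'_ℤ ∩ 𝓢'` of tempered distributions supported in `ℤ`. -/
def tempInt : Submodule ℂ Temp := (distrSupportedIn intSet).comap tempToDistr

/-- The Dirac distribution at `x`. -/
def diracDistr (x : ℝ) : Distr :=
  BoundedContinuousFunction.evalCLM ℂ x ∘L TestFunction.toBoundedContinuousFunctionCLM ℂ

@[simp]
theorem diracDistr_apply (x : ℝ) (f : Test) : diracDistr x f = f x := rfl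

/-- The derivative of a distribution: `⟨∂T | f⟩ = -⟨T | f'⟩`. -/
def distrDeriv : Distr →ₗ[ℂ] Distr where
  toFun T := -(T ∘L TestFunction.lineDerivCLM ℂ (1 : ℝ))
  map_add' T U := by
    ext f
    simp [add_comm]
  map_smul' c T := by
    ext f
    simp

/-- `T = ∑_{k ∈ ℤ} ∑_n a_{k,n} ∂ⁿ δ_k` with, for each `k`, only finitely many nonzero `a_{k,n}`;
the sum over `k` is the sum in the weak-* sense. -/
def HasExpansion (T : Distr) (a : ℤ → ℕ →₀ ℂ) : Prop :=
  ∀ f : Test, HasSum (fun k : ℤ => (a k).sum fun n c => c * (distrDeriv^[n] (diracDistr k)) f) (T f)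

/-- `O^q 𝓢'_ℤ`: the elements of `𝓢'_ℤ` of order at most `q`, that is, those whose expansion
`∑_k ∑_n a_{k,n} ∂ⁿ δ_k` has `a_{k,n} = 0` for all `k` and all `n > q`. -/
def orderFiltration (q : ℕ) : Submodule ℂ Temp where
  carrier := {T | T ∈ tempInt ∧
    ∃ a : ℤ → ℕ →₀ ℂ, HasExpansion (tempToDistr T) a ∧ ∀ k n, a k n ≠ 0 → n ≤ q}
  add_mem' := by
    rintro T U ⟨hT, a, ha, ha'⟩ ⟨hU, b, hb, hb'⟩
    refine ⟨tempInt.add_mem hT hU, a + b, fun f => ?_, fun k n h => ?_⟩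
    · have h : (fun k : ℤ => ((a + b) k).sum fun n c => c * (distrDeriv^[n] (diracDistr k)) f) =
          fun k : ℤ => ((a k).sum fun n c => c * (distrDeriv^[n] (diracDistr k)) f) +
            (b k).sum fun n c => c * (distrDeriv^[n] (diracDistr k)) f :=
        funext fun k => Finsupp.sum_add_index' (fun _ => zero_mul _) (fun _ _ _ => add_mul _ _ _)
      rw [h]
      exact (ha f).add (hb f)
    · by_contra hn
      have h1 : a k n = 0 := by
        by_contra h1
        exact hn (ha' k n h1)
      have h2 : b k n = 0 := by
        by_contra h2
        exact hn (hb' k n h2)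
      exact h (by simp [h1, h2])
  zero_mem' := ⟨tempInt.zero_mem, 0, fun f => by simp, fun k n h => absurd rfl h⟩
  smul_mem' := by
    rintro c T ⟨hT, a, ha, ha'⟩
    refine ⟨tempInt.smul_mem c hT, c • a, fun f => ?_, fun k n h => ?_⟩
    · have h : (fun k : ℤ => ((c • a) k).sum fun n c => c * (distrDeriv^[n] (diracDistr k)) f) =
          fun k : ℤ => c * (a k).sum fun n c => c * (distrDeriv^[n] (diracDistr k)) f :=
        funext fun k => by
          rw [Pi.smul_apply, Finsupp.sum_smul_index (fun _ => zero_mul _), Finsupp.mul_sum]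
          simp only [mul_assoc]
      rw [h]
      exact (ha f).mul_left c
    · refine ha' k n fun h0 => h ?_
      simp [h0]

end HigherOrder

end

/-!
Translation by an integer is unipotent on invariants of order `q`: if `g` is the generator of `ℤ`,
then the augmentation ideal is generated by `g - 1` (`augmentationIdeal_int`), so `T` is an
invariant of order `q` exactly when `(g - 1) ^ (q + 1) T = 0`, and then `g ^ k T` is a polynomial in
`k` of degree at most `q` with distribution coefficients (`apply_eq_sum_intChoose`).

*Temperedness.* Let `χ` be a test function whose integer translates sum to `1`. Then
`⟨T | f⟩ = ∑ k, ⟨g ^ k T | χ f(· + k)⟩`. The functions `χ f(· + k)` all live on `[-1, 1]`, where the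
finitely many coefficient distributions have finite order, so for Schwartz `f` the terms decay
faster than any power of `k` and the series defines a tempered extension of `T`
(`exists_tempered_extension`). It is unique because test functions are dense in the Schwartz space
(`tempered_ext`).

*Fourier side.* The Fourier transform turns `g - 1` into multiplication by
`symb x = exp (-2πix) - 1`, a smooth function with simple zeros exactly at the integers
(`mem_invariants_iff_fourierTemp`). Thus it remains to compare three conditions on a tempered `S`:

* `symb ^ (q + 1) S = 0` is equivalent to having an expansion of order at most `q`. By Hadamard's
  lemma (`contDiff_dslope`) a test function is divisible by `symb ^ (q + 1)` as soon as it vanishes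
  to order `q` at all integers (`exists_eq_mulTest_symb_pow`). Applied to a test function minus its
  localized Taylor polynomials this gives the expansion (`exists_hasExpansion`); the converse is the
  product rule.
* `symb ^ (q + 1) S = 0` implies that `S` is supported in `ℤ`, again by divisibility.
* If `S` is supported in `ℤ`, then some power of `symb` annihilates it (`exists_symb_pow_eq_zero`):
  `S` has finite order `N`, and for `m > 3 N` the function `symb ^ m f` can be cut off to the region
  `|symb| ≲ ε` without changing its pairing with `S`, while all derivatives up to order `N` of the
  cut off function are `O(ε)` (`exists_bound_iteratedDeriv_localized`).
-/

open scoped SchwartzMap Distributions ContDiff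

noncomputable section

namespace HigherOrder

/-! ### Higher order invariants of the integers -/

/-- The augmentation ideal of `R[ℤ]` is principal, generated by `g - 1` for the generator `g`. -/
theorem augmentationIdeal_int (R : Type*) [CommRing R] :
    augmentationIdeal R (Multiplicative ℤ) =
      Ideal.span {MonoidAlgebra.of R _ (Multiplicative.ofAdd (1 : ℤ)) - 1} := by
  set J := Ideal.span {MonoidAlgebra.of R _ (Multiplicative.ofAdd (1 : ℤ)) - 1} with hJ
  apply le_antisymm
  -- Modulo `g - 1` every group element becomes `1`, so the quotient map factors through the
  -- augmentation.
  · have key : Ideal.Quotient.mkₐ R J =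
        (Algebra.ofId R _).comp (MonoidAlgebra.lift R R (Multiplicative ℤ) 1) := by
      refine MonoidAlgebra.algHom_ext' (?_ : _ = _) (Subsingleton.elim _ _)
      apply MonoidHom.ext_mint
      have h : (Ideal.Quotient.mk J)
          (MonoidAlgebra.of R _ (Multiplicative.ofAdd (1 : ℤ)) - 1) = 0 :=
        Ideal.Quotient.eq_zero_iff_mem.2 (Ideal.subset_span rfl)
      rw [map_sub, sub_eq_zero, map_one (Ideal.Quotient.mk J)] at h
      simpa using h
    intro a ha
    have ha' : MonoidAlgebra.lift R R (Multiplicative ℤ) 1 a = 0 := ha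
    rw [← Ideal.Quotient.eq_zero_iff_mem]
    have := DFunLike.congr_fun key a
    simpa [ha'] using this
  · rw [hJ, Ideal.span_singleton_le_iff_mem]
    change MonoidAlgebra.lift R R (Multiplicative ℤ) 1 _ = 0
    simp

section

variable {R V : Type*} [CommRing R] [AddCommGroup V] [Module R V]

/-- Since the augmentation ideal of `R[ℤ]` is principal, the order of an invariant is detected by
the powers of the single operator `g - 1`. -/
theorem mem_invariants_int (ρ : Representation R (Multiplicative ℤ) V) (q : ℕ) (v : V) :
    v ∈ invariants ρ q ↔ ((ρ (Multiplicative.ofAdd 1) - 1) ^ (q + 1)) v = 0 := by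
  have hgen : ρ.asAlgebraHom ((MonoidAlgebra.of R _ (Multiplicative.ofAdd (1 : ℤ)) - 1) ^ (q + 1)) =
      (ρ (Multiplicative.ofAdd 1) - 1) ^ (q + 1) := by
    rw [map_pow, map_sub, Representation.asAlgebraHom_of, map_one ρ.asAlgebraHom]
  change (∀ a ∈ augmentationIdeal R (Multiplicative ℤ) ^ (q + 1), ρ.asAlgebraHom a v = 0) ↔ _
  rw [augmentationIdeal_int, Ideal.span_singleton_pow, ← hgen]
  constructor
  · exact fun h => h _ (Ideal.mem_span_singleton_self _)
  · intro h a ha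
    obtain ⟨b, rfl⟩ := Ideal.mem_span_singleton'.1 ha
    rw [map_mul, Module.End.mul_apply, h, map_zero]

/-- A linear map intertwining two endomorphisms intertwines their powers. -/
theorem map_pow_apply_of_intertwine {W : Type*} [AddCommGroup W] [Module R W] (L : V →ₗ[R] W)
    (A : Module.End R V) (B : Module.End R W) (h : ∀ v, L (A v) = B (L v)) (n : ℕ) (v : V) :
    L ((A ^ n) v) = (B ^ n) (L v) := by
  induction n generalizing v with
  | zero => rfl
  | succ n ih => rw [pow_succ, pow_succ, Module.End.mul_apply, Module.End.mul_apply, ih, h]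

end

/-- The generalized binomial coefficient `k (k - 1) ⋯ (k - i + 1) / i!`, for an integer `k` of
either sign. -/
def intChoose (k : ℤ) (i : ℕ) : ℂ := ∏ j ∈ Finset.range i, ((k : ℂ) - j) / (j + 1)

theorem intChoose_zero_right (k : ℤ) : intChoose k 0 = 1 := rfl

theorem intChoose_succ (k : ℤ) (i : ℕ) :
    intChoose k (i + 1) = intChoose k i * (((k : ℂ) - i) / (i + 1)) := Finset.prod_range_succ _ _

theorem intChoose_zero_succ (i : ℕ) : intChoose 0 (i + 1) = 0 :=
  Finset.prod_eq_zero (Finset.mem_range.2 i.succ_pos) (by simp)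

theorem intChoose_succ_succ (k : ℤ) (i : ℕ) :
    intChoose (k + 1) (i + 1) = intChoose k (i + 1) + intChoose k i := by
  induction i with
  | zero => simp [intChoose_succ, intChoose_zero_right]
  | succ i ih =>
    have h1 : (i : ℂ) + 1 ≠ 0 := by exact_mod_cast i.succ_ne_zero
    have h2 : (i : ℂ) + 1 + 1 ≠ 0 := by exact_mod_cast (i + 1).succ_ne_zero
    rw [intChoose_succ (k + 1) (i + 1), ih, intChoose_succ k (i + 1), intChoose_succ k i]
    push_cast
    field_simp
    ring

theorem norm_intChoose_le (k : ℤ) (i : ℕ) : ‖intChoose k i‖ ≤ (1 + |(k : ℝ)|) ^ i := by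
  rw [intChoose, norm_prod, ← Finset.card_range i, ← Finset.prod_const, Finset.card_range]
  refine Finset.prod_le_prod (fun _ _ => norm_nonneg _) fun j _ => ?_
  have h : ‖(k : ℂ) - j‖ ≤ |(k : ℝ)| + j := by
    refine (norm_sub_le _ _).trans (le_of_eq ?_)
    simp
  have h' : ‖(j : ℂ) + 1‖ = (j : ℝ) + 1 := by
    rw [← Nat.cast_succ, Complex.norm_natCast, Nat.cast_succ]
  rw [norm_div, h', div_le_iff₀ (by positivity)]
  nlinarith [abs_nonneg (k : ℝ), (Nat.cast_nonneg j : (0 : ℝ) ≤ j),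
    mul_nonneg (abs_nonneg (k : ℝ)) (Nat.cast_nonneg j : (0 : ℝ) ≤ j)]

/-- On an invariant of order `q` the group acts by polynomials of degree at most `q`: this is the
binomial expansion of `g ^ k = (1 + (g - 1)) ^ k`, valid also for negative `k`. -/
theorem apply_eq_sum_intChoose {V : Type*} [AddCommGroup V] [Module ℂ V]
    (ρ : Representation ℂ (Multiplicative ℤ) V) {q : ℕ} {v : V} (hv : v ∈ invariants ρ q) (k : ℤ) :
    ρ (Multiplicative.ofAdd k) v = ∑ i ∈ Finset.range (q + 1),
      intChoose k i • ((ρ (Multiplicative.ofAdd 1) - 1) ^ i) v := by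
  rw [mem_invariants_int] at hv
  set A := ρ (Multiplicative.ofAdd (1 : ℤ)) with hA
  set F : ℤ → V := fun k => ∑ i ∈ Finset.range (q + 1), intChoose k i • ((A - 1) ^ i) v with hF
  have hF0 : F 0 = v := by
    rw [hF]
    simp only
    rw [Finset.sum_range_succ']
    simp [intChoose_zero_succ, intChoose_zero_right]
  have hstep : ∀ k, F (k + 1) = A (F k) := by
    intro k
    -- This is Pascal's rule; the top term disappears because `(A - 1) ^ (q + 1) v = 0`.
    have h1 : A (F k) = F k + (A - 1) (F k) := by simp
    have h2 : (A - 1) (F k) = ∑ i ∈ Finset.range q, intChoose k i • ((A - 1) ^ (i + 1)) v := by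
      simp only [hF, map_sum, map_smul]
      rw [Finset.sum_range_succ]
      simp only [← Module.End.mul_apply, ← pow_succ']
      rw [hv, smul_zero, add_zero]
    rw [h1, h2]
    simp only [hF]
    rw [Finset.sum_range_succ', Finset.sum_range_succ' _ q]
    simp only [intChoose_succ_succ, add_smul, Finset.sum_add_distrib, intChoose_zero_right]
    abel
  have hρ : ∀ k : ℤ, ρ (Multiplicative.ofAdd (k + 1)) v = A (ρ (Multiplicative.ofAdd k) v) := by
    intro k
    rw [add_comm, ofAdd_add, map_mul, Module.End.mul_apply]
  -- Injectivity of `A` carries the identity to negative `k`.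
  have hinj : Function.Injective A := by
    intro x y hxy
    have := congrArg (ρ (Multiplicative.ofAdd (-1 : ℤ))) hxy
    rw [hA] at this
    simpa only [← Module.End.mul_apply, ← map_mul, ← ofAdd_add, neg_add_cancel, ofAdd_zero, map_one,
      Module.End.one_apply] using this
  change _ = F k
  induction k with
  | zero => rw [ofAdd_zero, map_one, hF0]; rfl
  | succ n ih => rw [hρ, hstep, ih]
  | pred n ih =>
    apply hinj
    rw [← hρ, ← hstep, sub_add_cancel, ih]

/-! ### Density of the test functions in the Schwartz space -/

theorem exists_bound_iteratedFDeriv {f : ℝ → ℂ} (hf : ContDiff ℝ ∞ f) (hc : HasCompactSupport f)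
    (i : ℕ) : ∃ C, 0 ≤ C ∧ ∀ x, ‖iteratedFDeriv ℝ i f x‖ ≤ C := by
  obtain ⟨C, hC⟩ := (hc.iteratedFDeriv (𝕜 := ℝ) i).exists_bound_of_continuous
    (hf.continuous_iteratedFDeriv (mod_cast le_top))
  exact ⟨C, (norm_nonneg _).trans (hC 0), hC⟩

/-- The product of a test function with a smooth function. -/
def mulTest (g : ℝ → ℂ) (hg : ContDiff ℝ ∞ g) (f : Test) : Test :=
  ⟨fun x => g x * f x, hg.mul f.contDiff, f.hasCompactSupport.mul_left, Set.subset_univ _⟩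

@[simp]
theorem mulTest_apply (g : ℝ → ℂ) (hg : ContDiff ℝ ∞ g) (f : Test) (x : ℝ) :
    mulTest g hg f x = g x * f x := rfl

/-- A plateau function: a test function that equals `1` on `[-1, 1]`. -/
def plateau : Test :=
  let b : ContDiffBump (0 : ℝ) := ⟨1, 2, one_pos, one_lt_two⟩
  ⟨fun x => (b x : ℂ), Complex.ofRealCLM.contDiff.comp b.contDiff,
    b.hasCompactSupport.comp_left Complex.ofReal_zero, Set.subset_univ _⟩

theorem plateau_eq_one {x : ℝ} (hx : |x| ≤ 1) : plateau x = 1 := by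
  let b : ContDiffBump (0 : ℝ) := ⟨1, 2, one_pos, one_lt_two⟩
  have h : b x = 1 := b.one_of_mem_closedBall (by simpa [b] using hx)
  change ((b x : ℝ) : ℂ) = 1
  rw [h, Complex.ofReal_one]

theorem plateau_eq_zero {x : ℝ} (hx : 2 ≤ |x|) : plateau x = 0 := by
  let b : ContDiffBump (0 : ℝ) := ⟨1, 2, one_pos, one_lt_two⟩
  have h : b x = 0 := b.zero_of_le_dist (by simpa [b] using hx)
  change ((b x : ℝ) : ℂ) = 0
  rw [h, Complex.ofReal_zero]

theorem contDiff_comp_mul_left {g : ℝ → ℂ} (hg : ContDiff ℝ ∞ g) (c : ℝ) :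
    ContDiff ℝ ∞ fun x => g (c * x) := hg.comp (contDiff_const.mul contDiff_id)

/-- The truncation of a Schwartz function by the plateau of width `n + 1`. -/
def truncate (f : 𝓢(ℝ, ℂ)) (n : ℕ) : Test :=
  ⟨fun x => plateau ((n + 1 : ℝ)⁻¹ * x) * f x,
    (contDiff_comp_mul_left plateau.contDiff _).mul (f.smooth ⊤),
    (plateau.hasCompactSupport.comp_homeomorph
      (Homeomorph.mulLeft₀ (n + 1 : ℝ)⁻¹ (by positivity))).mul_right, Set.subset_univ _⟩

/-- The derivatives of the plateaus of width at least `1`, minus `1`, are uniformly bounded. -/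
theorem exists_bound_plateau_sub_one (i : ℕ) : ∃ C, 0 ≤ C ∧ ∀ c : ℝ, 0 ≤ c → c ≤ 1 → ∀ x,
    ‖iteratedFDeriv ℝ i (fun y => plateau (c * y) - 1) x‖ ≤ C := by
  obtain ⟨C, hC0, hC⟩ := exists_bound_iteratedFDeriv plateau.contDiff plateau.hasCompactSupport i
  refine ⟨C + 1, by positivity, fun c hc0 hc1 x => ?_⟩
  have hsm : ContDiff ℝ ∞ fun y => plateau (c * y) := contDiff_comp_mul_left plateau.contDiff c
  have hi : ((i : ℕ∞) : WithTop ℕ∞) ≤ ∞ := mod_cast le_top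
  rw [norm_iteratedFDeriv_eq_norm_iteratedDeriv]
  have h1 : iteratedDeriv i (fun y => plateau (c * y) - 1) x =
      iteratedDeriv i (fun y => plateau (c * y)) x - iteratedDeriv i (fun _ => (1 : ℂ)) x :=
    iteratedDeriv_sub (hsm.contDiffAt.of_le hi) contDiffAt_const
  have h2 : iteratedDeriv i (fun y => plateau (c * y)) x =
      c ^ i • iteratedDeriv i plateau (c * x) :=
    congrFun (iteratedDeriv_comp_const_smul (plateau.contDiff.of_le hi) c) x
  rw [h1, h2]
  refine (norm_sub_le _ _).trans (add_le_add ?_ ?_)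
  · rw [norm_smul, ← norm_iteratedFDeriv_eq_norm_iteratedDeriv, norm_pow, Real.norm_of_nonneg hc0]
    calc _ ≤ 1 * C := mul_le_mul (pow_le_one₀ hc0 hc1) (hC _) (norm_nonneg _) zero_le_one
      _ = C := one_mul C
  · rw [iteratedDeriv_const]
    split_ifs <;> simp

theorem tendsto_truncate (f : 𝓢(ℝ, ℂ)) :
    Filter.Tendsto (fun n => testToSchwartz (truncate f n)) Filter.atTop (nhds f) := by
  rw [(schwartz_withSeminorms ℂ ℝ ℂ).tendsto_nhds]
  rintro ⟨a, b⟩ ε hε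
  choose B hB0 hB using exists_bound_plateau_sub_one
  set C : ℝ := ∑ i ∈ Finset.range (b + 1),
    (b.choose i : ℝ) * B i * SchwartzMap.seminorm ℂ (a + 1) (b - i) f with hC
  have hC0 : 0 ≤ C := Finset.sum_nonneg fun i _ =>
    mul_nonneg (mul_nonneg (Nat.cast_nonneg _) (hB0 i)) (apply_nonneg _ _)
  have hbound : ∀ n : ℕ, SchwartzMap.seminorm ℂ a b (testToSchwartz (truncate f n) - f) ≤
      C / (n + 1) := by
    intro n
    have hn : (0 : ℝ) < n + 1 := by positivity
    refine SchwartzMap.seminorm_le_bound ℂ a b _ (by positivity) fun x => ?_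
    set g : ℝ → ℂ := fun y => plateau ((n + 1 : ℝ)⁻¹ * y) - 1 with hg
    have hfun : ⇑(testToSchwartz (truncate f n) - f) = fun y => g y * f y := by
      ext y
      change plateau ((n + 1 : ℝ)⁻¹ * y) * f y - f y = _
      simp only [hg]
      ring
    rw [hfun]
    rcases lt_or_ge |x| (n + 1 : ℝ) with hx | hx
    -- The plateau is locally `1` here, so the difference vanishes near `x`.
    · have hev : (fun y => g y * f y) =ᶠ[nhds x] fun _ => 0 := by
        filter_upwards [continuous_abs.continuousAt.eventually_lt continuousAt_const hx] with y hy
        have : plateau ((n + 1 : ℝ)⁻¹ * y) = 1 := by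
          apply plateau_eq_one
          rw [abs_mul, abs_inv, abs_of_pos hn, inv_mul_le_iff₀ hn, mul_one]
          exact hy.le
        simp [hg, this]
      rw [(hev.iteratedFDeriv ℝ b).eq_of_nhds]
      simp only [iteratedFDeriv_fun_zero, Pi.zero_apply, norm_zero, mul_zero]
      positivity
    · have hx0 : 0 < |x| := hn.trans_le hx
      have hgs : ContDiff ℝ ∞ g := (contDiff_comp_mul_left plateau.contDiff _).sub contDiff_const
      have hb : ((b : ℕ∞) : WithTop ℕ∞) ≤ ∞ := mod_cast le_top
      have hL := norm_iteratedFDeriv_mul_le (hgs.of_le hb) ((f.smooth ⊤).of_le hb) x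
        (n := b) le_rfl
      calc ‖x‖ ^ a * ‖iteratedFDeriv ℝ b (fun y => g y * f y) x‖
          ≤ ‖x‖ ^ a * ∑ i ∈ Finset.range (b + 1), (b.choose i : ℝ) * ‖iteratedFDeriv ℝ i g x‖ *
              ‖iteratedFDeriv ℝ (b - i) f x‖ := by gcongr
        _ = ∑ i ∈ Finset.range (b + 1), (b.choose i : ℝ) * ‖iteratedFDeriv ℝ i g x‖ *
              (‖x‖ ^ a * ‖iteratedFDeriv ℝ (b - i) f x‖) := by
            rw [Finset.mul_sum]
            exact Finset.sum_congr rfl fun i _ => by ring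
        _ ≤ ∑ i ∈ Finset.range (b + 1), (b.choose i : ℝ) * B i *
              (SchwartzMap.seminorm ℂ (a + 1) (b - i) f / (n + 1)) := by
            refine Finset.sum_le_sum fun i _ => ?_
            have h1 : ‖iteratedFDeriv ℝ i g x‖ ≤ B i :=
              hB i _ (by positivity)
                (inv_le_one_of_one_le₀ (by linarith [n.cast_nonneg (α := ℝ)])) x
            have h2 : ‖x‖ ^ a * ‖iteratedFDeriv ℝ (b - i) f x‖ ≤
                SchwartzMap.seminorm ℂ (a + 1) (b - i) f / (n + 1) := by
              rw [le_div_iff₀ hn]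
              calc _ ≤ ‖x‖ ^ a * ‖iteratedFDeriv ℝ (b - i) f x‖ * ‖x‖ := by gcongr; exact hx
                _ = ‖x‖ ^ (a + 1) * ‖iteratedFDeriv ℝ (b - i) f x‖ := by ring
                _ ≤ _ := SchwartzMap.le_seminorm ℂ (a + 1) (b - i) f x
            have := hB0 i
            gcongr
        _ = C / (n + 1) := by
            rw [hC, Finset.sum_div]
            exact Finset.sum_congr rfl fun i _ => by ring
  have hlim : Filter.Tendsto (fun n : ℕ => C / ((n : ℝ) + 1)) Filter.atTop (nhds 0) := by
    simpa [div_eq_mul_inv] using tendsto_one_div_add_atTop_nhds_zero_nat.const_mul C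
  filter_upwards [hlim.eventually (gt_mem_nhds hε)] with n hn
  exact (hbound n).trans_lt hn

/-- Test functions are dense: a tempered distribution is determined by its values on them. -/
theorem tempered_ext {S T : Temp} (h : ∀ f : Test, S (testToSchwartz f) = T (testToSchwartz f)) :
    S = T := by
  refine ContinuousLinearMap.ext fun f => ?_
  have hS := ((map_continuous S).tendsto f).comp (tendsto_truncate f)
  have hT := ((map_continuous T).tendsto f).comp (tendsto_truncate f)
  exact tendsto_nhds_unique (hS.congr fun n => h _) hT

theorem tempToDistr_injective : Function.Injective tempToDistr := fun _ _ h =>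
  tempered_ext fun f => DFunLike.congr_fun h f

/-! ### Higher order invariant distributions are tempered -/

/-- A test function supported in `[-1, 1]` whose integer translates sum to `1`. -/
def unitPartition : Test :=
  ⟨fun x => (Real.smoothTransition (x + 1) - Real.smoothTransition x : ℝ),
    Complex.ofRealCLM.contDiff.comp
      ((Real.smoothTransition.contDiff.comp (contDiff_id.add contDiff_const)).sub
        Real.smoothTransition.contDiff),
    HasCompactSupport.intro (isCompact_Icc (a := (-1 : ℝ)) (b := 1)) fun x hx => by
      rw [Set.mem_Icc, not_and_or, not_le, not_le] at hx
      rcases hx with hx | hx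
      · rw [Real.smoothTransition.zero_of_nonpos (by linarith),
          Real.smoothTransition.zero_of_nonpos (by linarith), sub_zero, Complex.ofReal_zero]
      · rw [Real.smoothTransition.one_of_one_le (by linarith),
          Real.smoothTransition.one_of_one_le hx.le, sub_self, Complex.ofReal_zero],
    Set.subset_univ _⟩

theorem unitPartition_apply (x : ℝ) : unitPartition x =
    ((Real.smoothTransition (x + 1) - Real.smoothTransition x : ℝ) : ℂ) := rfl

theorem unitPartition_eq_zero {x : ℝ} (hx : 1 ≤ |x|) : unitPartition x = 0 := by
  rw [unitPartition_apply]
  rcases le_abs.1 hx with hx | hx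
  · rw [Real.smoothTransition.one_of_one_le (by linarith),
      Real.smoothTransition.one_of_one_le hx, sub_self, Complex.ofReal_zero]
  · rw [Real.smoothTransition.zero_of_nonpos (by linarith),
      Real.smoothTransition.zero_of_nonpos (by linarith), sub_zero, Complex.ofReal_zero]

theorem sum_unitPartition (n : ℕ) {x : ℝ} (hx : |x| ≤ n) :
    ∑ k ∈ Finset.Icc (-n : ℤ) n, unitPartition (x - k) = 1 := by
  have hn : ((n : ℤ) + 1 - -n).toNat = 2 * n + 1 := by omega
  rw [Int.Icc_eq_finset_map, Finset.sum_map, hn]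
  -- The sum telescopes.
  have h : ∀ j ∈ Finset.range (2 * n + 1),
      unitPartition (x - (((Nat.castEmbedding.trans (addLeftEmbedding (-n : ℤ))) j : ℤ) : ℝ)) =
        (Real.smoothTransition (x + n + 1 - j) : ℂ) -
          (Real.smoothTransition (x + n + 1 - (j + 1 : ℕ)) : ℂ) := by
    intro j _
    rw [unitPartition_apply, Complex.ofReal_sub]
    simp only [Function.Embedding.trans_apply, Nat.castEmbedding_apply, addLeftEmbedding_apply]
    push_cast
    congr 3 <;> ring
  rw [Finset.sum_congr rfl h,
    Finset.sum_range_sub' (fun j : ℕ => (Real.smoothTransition (x + n + 1 - j) : ℂ)),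
    Real.smoothTransition.one_of_one_le, Real.smoothTransition.zero_of_nonpos]
  · simp
  · push_cast
    linarith [le_abs_self x]
  · push_cast
    linarith [neg_abs_le x]

theorem contDiff_comp_add_right {g : ℝ → ℂ} (hg : ContDiff ℝ ∞ g) (a : ℝ) :
    ContDiff ℝ ∞ fun x => g (x + a) := hg.comp (contDiff_id.add contDiff_const)

/-- The piece of a Schwartz function near the integer `k`, translated to the origin. -/
def localPiece (k : ℤ) (f : 𝓢(ℝ, ℂ)) : Test :=
  mulTest (fun x => f (x + k)) (contDiff_comp_add_right (f.smooth ⊤) k) unitPartition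

/-- A distribution has finite order on `[-1, 1]`, so its values on the translated pieces of a
Schwartz function decay rapidly. -/
theorem norm_apply_localPiece_le (S : Distr) (M : ℕ) : ∃ (s : Finset (ℕ × ℕ)) (C : ℝ), 0 ≤ C ∧
    ∀ (f : 𝓢(ℝ, ℂ)) (k : ℤ), ‖S (localPiece k f)‖ ≤
      C * s.sup (schwartzSeminormFamily ℂ ℝ ℂ) f / (1 + |(k : ℝ)|) ^ M := by
  let K : TopologicalSpace.Compacts ℝ := ⟨Set.Icc (-1) 1, isCompact_Icc⟩
  have hKs : (K : Set ℝ) ⊆ (⊤ : TopologicalSpace.Opens ℝ) := Set.subset_univ _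
  let L : 𝓓_{K}(ℝ, ℂ) →L[ℂ] ℂ := S ∘L TestFunction.ofSupportedInCLM ℂ hKs
  obtain ⟨t, C, -, hC⟩ := Seminorm.bound_of_continuous
    (ContDiffMapSupportedIn.withSeminorms ℂ ℝ ℂ ⊤ K) ((normSeminorm ℂ ℂ).comp L.toLinearMap)
    (continuous_norm.comp L.continuous)
  choose B hB0 hB using fun i =>
    exists_bound_iteratedFDeriv unitPartition.contDiff unitPartition.hasCompactSupport i
  set N := t.sup id with hN
  set D : ℝ := ∑ i ∈ t, ∑ j ∈ Finset.range (i + 1), (i.choose j : ℝ) * B (i - j) with hD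
  have hD1 : ∀ i, 0 ≤ ∑ j ∈ Finset.range (i + 1), (i.choose j : ℝ) * B (i - j) := fun i =>
    Finset.sum_nonneg fun j _ => mul_nonneg (Nat.cast_nonneg _) (hB0 _)
  have hD0 : 0 ≤ D := Finset.sum_nonneg fun i _ => hD1 i
  refine ⟨Finset.Iic (M, N), C * (D * (2 ^ M * 2 ^ M)), by positivity, fun f k => ?_⟩
  set P : ℝ := (Finset.Iic (M, N)).sup (schwartzSeminormFamily ℂ ℝ ℂ) f with hP
  have hP0 : 0 ≤ P := apply_nonneg _ _
  have hk0 : 0 < 1 + |(k : ℝ)| := by positivity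
  let g : 𝓓_{K}(ℝ, ℂ) := ⟨fun x => f (x + k) * unitPartition x,
    (contDiff_comp_add_right (f.smooth ⊤) k).mul unitPartition.contDiff, fun x hx => by
      have : 1 ≤ |x| := by
        by_contra! h
        exact hx ⟨(abs_le.1 h.le).1, (abs_le.1 h.le).2⟩
      simp [unitPartition_eq_zero this]⟩
  have hdecay : ∀ j ≤ N, ∀ x ∈ K, ‖iteratedFDeriv ℝ j (fun y => f (y + k)) x‖ ≤
      2 ^ M * 2 ^ M * P / (1 + |(k : ℝ)|) ^ M := by
    intro j hj x hx
    have hx1 : |x| ≤ 1 := abs_le.2 hx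
    rw [iteratedFDeriv_comp_add_right]
    have h1 := SchwartzMap.one_add_le_sup_seminorm_apply (𝕜 := ℂ) (m := (M, N)) (k := M) (n := j)
      le_rfl hj f (x + k)
    have h2 : 1 + |(k : ℝ)| ≤ 2 * (1 + ‖x + k‖) := by
      have : |(k : ℝ)| ≤ |x + k| + |x| := by
        calc |(k : ℝ)| = |(x + k) - x| := by ring_nf
          _ ≤ _ := abs_sub _ _
      rw [Real.norm_eq_abs]
      linarith [abs_nonneg (x + k)]
    rw [le_div_iff₀ (by positivity)]
    calc ‖iteratedFDeriv ℝ j f (x + k)‖ * (1 + |(k : ℝ)|) ^ M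
        ≤ ‖iteratedFDeriv ℝ j f (x + k)‖ * (2 * (1 + ‖x + k‖)) ^ M := by gcongr
      _ = 2 ^ M * ((1 + ‖x + k‖) ^ M * ‖iteratedFDeriv ℝ j f (x + k)‖) := by rw [mul_pow]; ring
      _ ≤ 2 ^ M * (2 ^ M * P) := mul_le_mul_of_nonneg_left h1 (by positivity)
      _ = 2 ^ M * 2 ^ M * P := by ring
  have hg : t.sup (ContDiffMapSupportedIn.seminorm ℂ ℝ ℂ ⊤ K) g ≤
      D * (2 ^ M * 2 ^ M * P / (1 + |(k : ℝ)|) ^ M) := by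
    refine Seminorm.finset_sup_apply_le (by positivity) fun i hi => ?_
    rw [ContDiffMapSupportedIn.seminorm_top_le_iff ℂ (by positivity)]
    intro x hx
    have hle : ((i : ℕ∞) : WithTop ℕ∞) ≤ ∞ := mod_cast le_top
    have hLeib := norm_iteratedFDeriv_mul_le
      ((contDiff_comp_add_right (f.smooth ⊤) k).of_le hle) (unitPartition.contDiff.of_le hle) x
      (n := i) le_rfl
    have hiN : i ≤ N := Finset.le_sup (f := id) hi
    calc ‖iteratedFDeriv ℝ i g x‖ ≤ _ := hLeib
      _ ≤ ∑ j ∈ Finset.range (i + 1), (i.choose j : ℝ) *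
            (2 ^ M * 2 ^ M * P / (1 + |(k : ℝ)|) ^ M) * B (i - j) := by
          refine Finset.sum_le_sum fun j hj => ?_
          have h1 := hdecay j ((Nat.lt_succ_iff.1 (Finset.mem_range.1 hj)).trans hiN) x hx
          have h2 := hB (i - j) x
          gcongr
      _ = (∑ j ∈ Finset.range (i + 1), (i.choose j : ℝ) * B (i - j)) *
            (2 ^ M * 2 ^ M * P / (1 + |(k : ℝ)|) ^ M) := by
          rw [Finset.sum_mul]
          exact Finset.sum_congr rfl fun j _ => by ring
      _ ≤ _ := by
          gcongr
          exact Finset.single_le_sum (f := fun i => ∑ j ∈ Finset.range (i + 1),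
            (i.choose j : ℝ) * B (i - j)) (fun i _ => hD1 i) hi
  calc ‖S (localPiece k f)‖ = ‖L g‖ := rfl
    _ ≤ C * t.sup (ContDiffMapSupportedIn.seminorm ℂ ℝ ℂ ⊤ K) g := hC g
    _ ≤ C * (D * (2 ^ M * 2 ^ M * P / (1 + |(k : ℝ)|) ^ M)) := by gcongr
    _ = _ := by ring

/-- For an invariant of order `q`, the values on the pieces of a Schwartz function are summable:
the rapid decay beats the polynomial growth of the group action. -/
theorem norm_translate_localPiece_le {q : ℕ} {T : Distr} (hT : T ∈ invariants translateDistr q) :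
    ∃ (s : Finset (ℕ × ℕ)) (C : ℝ), 0 ≤ C ∧ ∀ (f : 𝓢(ℝ, ℂ)) (k : ℤ),
      ‖translateDistr (Multiplicative.ofAdd k) T (localPiece k f)‖ ≤
        C * s.sup (schwartzSeminormFamily ℂ ℝ ℂ) f * (1 / (1 + |(k : ℝ)|) ^ 2) := by
  choose s C hC0 hC using fun i : ℕ => norm_apply_localPiece_le
    (((translateDistr (Multiplicative.ofAdd 1) - 1) ^ i) T) (q + 2)
  refine ⟨(Finset.range (q + 1)).biUnion s, ∑ i ∈ Finset.range (q + 1), C i,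
    Finset.sum_nonneg fun i _ => hC0 i, fun f k => ?_⟩
  rw [apply_eq_sum_intChoose translateDistr hT k, sum_apply]
  refine (norm_sum_le _ _).trans ?_
  rw [Finset.sum_mul, Finset.sum_mul]
  refine Finset.sum_le_sum fun i hi => ?_
  have hk1 : 1 ≤ 1 + |(k : ℝ)| := by linarith [abs_nonneg (k : ℝ)]
  have hk0 : 0 < 1 + |(k : ℝ)| := by positivity
  have hsup : (s i).sup (schwartzSeminormFamily ℂ ℝ ℂ) f ≤
      ((Finset.range (q + 1)).biUnion s).sup (schwartzSeminormFamily ℂ ℝ ℂ) f :=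
    Finset.sup_mono (f := schwartzSeminormFamily ℂ ℝ ℂ) (Finset.subset_biUnion_of_mem s hi) f
  have hi' : i ≤ q := Nat.lt_succ_iff.1 (Finset.mem_range.1 hi)
  rw [smul_apply, norm_smul]
  calc _ ≤ (1 + |(k : ℝ)|) ^ q *
        (C i * (s i).sup (schwartzSeminormFamily ℂ ℝ ℂ) f / (1 + |(k : ℝ)|) ^ (q + 2)) :=
        mul_le_mul ((norm_intChoose_le k i).trans (pow_le_pow_right₀ hk1 hi')) (hC i f k)
          (norm_nonneg _) (by positivity)
    _ = C i * (s i).sup (schwartzSeminormFamily ℂ ℝ ℂ) f * (1 / (1 + |(k : ℝ)|) ^ 2) := by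
        field_simp
        ring
    _ ≤ _ := by
        have := hC0 i
        gcongr

theorem summable_one_div_one_add_abs_sq : Summable fun k : ℤ => 1 / (1 + |(k : ℝ)|) ^ 2 := by
  have h : Summable fun n : ℕ => 1 / (1 + (n : ℝ)) ^ 2 := by
    have := (summable_nat_add_iff 1).2 (Real.summable_one_div_nat_pow.2 one_lt_two)
    refine this.congr fun n => ?_
    push_cast
    rw [add_comm]
  refine Summable.of_nat_of_neg ?_ ?_ <;> simpa using h

theorem localPiece_add (k : ℤ) (f g : 𝓢(ℝ, ℂ)) :
    localPiece k (f + g) = localPiece k f + localPiece k g :=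
  TestFunction.ext fun x => add_mul (f (x + k)) (g (x + k)) (unitPartition x)

theorem localPiece_smul (k : ℤ) (c : ℂ) (f : 𝓢(ℝ, ℂ)) :
    localPiece k (c • f) = c • localPiece k f :=
  TestFunction.ext fun x => mul_assoc c (f (x + k)) (unitPartition x)

/-- Every higher order invariant distribution is the restriction of a tempered distribution,
namely of `f ↦ ∑ k, ⟨T | χ (· - k) f⟩`, where the translates of `χ` form a partition of unity. -/
theorem exists_tempered_extension {q : ℕ} {T : Distr} (hT : T ∈ invariants translateDistr q) :
    ∃ S : Temp, tempToDistr S = T := by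
  obtain ⟨s, C, hC0, hC⟩ := norm_translate_localPiece_le hT
  set F : ℤ → 𝓢(ℝ, ℂ) → ℂ :=
    fun k f => translateDistr (Multiplicative.ofAdd k) T (localPiece k f) with hF
  have hsum : ∀ f, Summable fun k => F k f := fun f =>
    Summable.of_norm_bounded (summable_one_div_one_add_abs_sq.mul_left _) (hC f)
  let S : 𝓢(ℝ, ℂ) →L[ℂ] ℂ := SchwartzMap.mkCLMtoNormedSpace (σ := RingHom.id ℂ)
    (fun f => ∑' k, F k f)
    (fun f g => by
      rw [← (hsum f).tsum_add (hsum g)]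
      exact tsum_congr fun k => by simp only [hF, localPiece_add, map_add])
    (fun c f => by
      rw [RingHom.id_apply, smul_eq_mul, ← tsum_mul_left]
      exact tsum_congr fun k => by simp only [hF, localPiece_smul, map_smul, smul_eq_mul])
    ⟨s, C * ∑' k : ℤ, 1 / (1 + |(k : ℝ)|) ^ 2,
      mul_nonneg hC0 (tsum_nonneg fun k => by positivity), fun f => by
        refine (tsum_of_norm_bounded
          (summable_one_div_one_add_abs_sq.hasSum.mul_left _) (hC f)).trans (le_of_eq ?_)
        ring⟩
  refine ⟨(S : 𝓢(ℝ, ℂ) →L[ℂ] ℂ), ContinuousLinearMap.ext fun f => ?_⟩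
  change ∑' k, F k (testToSchwartz f) = T f
  obtain ⟨r, hr⟩ := f.hasCompactSupport.isBounded.exists_norm_le
  obtain ⟨n, hn⟩ := exists_nat_ge (|r| + 1)
  have hf : ∀ x : ℝ, |r| < |x| → f x = 0 := fun x hx => by
    by_contra h
    exact absurd ((hr x (subset_tsupport f h)).trans (le_abs_self r)) (not_le.2 hx)
  have hzero : ∀ k ∉ Finset.Icc (-n : ℤ) n, F k (testToSchwartz f) = 0 := by
    intro k hk
    have hk' : (n : ℝ) < |(k : ℝ)| := by
      by_contra! h
      apply hk
      rw [Finset.mem_Icc]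
      exact ⟨by exact_mod_cast (abs_le.1 h).1, by exact_mod_cast (abs_le.1 h).2⟩
    have : localPiece k (testToSchwartz f) = 0 := by
      refine TestFunction.ext fun x => ?_
      change f (x + k) * unitPartition x = 0
      rcases le_or_gt 1 |x| with hx | hx
      · rw [unitPartition_eq_zero hx, mul_zero]
      · rw [hf, zero_mul]
        have : |(k : ℝ)| ≤ |x + k| + |x| := by
          calc |(k : ℝ)| = |(x + k) - x| := by ring_nf
            _ ≤ _ := abs_sub _ _
        linarith
    simp only [hF, this, map_zero]
  rw [tsum_eq_sum hzero]
  simp only [hF]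
  change ∑ k ∈ Finset.Icc (-n : ℤ) n,
    T (translateTest (k : ℝ) (localPiece k (testToSchwartz f))) = _
  rw [← map_sum]
  congr 1
  refine TestFunction.ext fun x => ?_
  have heval : ∀ s : Finset ℤ,
      (∑ k ∈ s, translateTest (k : ℝ) (localPiece k (testToSchwartz f))) x =
      ∑ k ∈ s, f x * unitPartition (x - k) := by
    intro s
    have := map_sum (diracDistr x)
      (fun k : ℤ => translateTest (k : ℝ) (localPiece k (testToSchwartz f))) s
    refine this.trans (Finset.sum_congr rfl fun k _ => ?_)
    change f (x - k + k) * unitPartition (x - k) = _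
    rw [sub_add_cancel]
  rw [heval, ← Finset.mul_sum]
  rcases le_or_gt |x| n with hx | hx
  · rw [sum_unitPartition n hx, mul_one]
  · rw [hf x (by linarith), zero_mul]

theorem tempToDistr_translate (g : Multiplicative ℤ) (T : Temp) :
    tempToDistr (translateTemp g T) = translateDistr g (tempToDistr T) := rfl

theorem tempToDistr_mem_invariants (q : ℕ) (T : Temp) :
    tempToDistr T ∈ invariants translateDistr q ↔ T ∈ invariants translateTemp q := by
  rw [mem_invariants_int, mem_invariants_int, ← map_pow_apply_of_intertwine tempToDistr
    (translateTemp (Multiplicative.ofAdd 1) - 1), map_eq_zero_iff _ tempToDistr_injective]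
  intro v
  simp only [LinearMap.sub_apply, Module.End.one_apply, map_sub, tempToDistr_translate]

theorem map_tempToDistr_invariants (q : ℕ) :
    (invariants translateTemp q).map tempToDistr = invariants translateDistr q := by
  ext T
  rw [Submodule.mem_map]
  constructor
  · rintro ⟨S, hS, rfl⟩
    exact (tempToDistr_mem_invariants q S).2 hS
  · intro hT
    obtain ⟨S, rfl⟩ := exists_tempered_extension hT
    exact ⟨S, (tempToDistr_mem_invariants q S).1 hT, rfl⟩

/-! ### Division of smooth functions -/

/-- The weight `t ^ n` makes the family of these integrals stable under differentiation in `x`. -/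
theorem hasDerivAt_integral_pow_mul_comp_segment {h : ℝ → ℂ} (hh : ContDiff ℝ ∞ h) (a : ℝ) (n : ℕ)
    (x₀ : ℝ) : HasDerivAt (fun x => ∫ t in (0 : ℝ)..1, (t : ℂ) ^ n * h (a + t * (x - a)))
      (∫ t in (0 : ℝ)..1, (t : ℂ) ^ (n + 1) * deriv h (a + t * (x₀ - a))) x₀ := by
  have hd : Continuous (deriv h) := hh.continuous_deriv (by simp)
  have hc : Continuous h := hh.continuous
  -- On the unit ball around `x₀` the segments stay in a fixed compact set.
  obtain ⟨C, hC⟩ := ((isCompact_Icc (a := (0 : ℝ)) (b := 1)).prod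
    (isCompact_closedBall x₀ 1)).exists_bound_of_continuousOn
    (f := fun p : ℝ × ℝ => (p.1 : ℂ) ^ (n + 1) * deriv h (a + p.1 * (p.2 - a)))
    (by fun_prop)
  refine (intervalIntegral.hasDerivAt_integral_of_dominated_loc_of_deriv_le
    (F := fun x t => (t : ℂ) ^ n * h (a + t * (x - a)))
    (F' := fun x t => (t : ℂ) ^ (n + 1) * deriv h (a + t * (x - a)))
    (bound := fun _ => C) (s := Metric.ball x₀ 1) (Metric.ball_mem_nhds x₀ one_pos)
    (.of_forall fun x => ?_) ?_ ?_ (.of_forall fun t ht x hx => ?_) ?_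
    (.of_forall fun t _ x _ => ?_)).2
  · exact Continuous.aestronglyMeasurable (by fun_prop)
  · exact Continuous.intervalIntegrable (by fun_prop) _ _
  · exact Continuous.aestronglyMeasurable (by fun_prop)
  · rw [Set.uIoc_of_le zero_le_one] at ht
    exact hC (t, x) ⟨⟨ht.1.le, ht.2⟩, Metric.ball_subset_closedBall hx⟩
  · exact intervalIntegrable_const
  · have h1 : HasDerivAt (fun x => a + t * (x - a)) t x := by
      simpa using (((hasDerivAt_id x).sub_const a).const_mul t).const_add a
    have h2 : HasDerivAt h (deriv h (a + t * (x - a))) (a + t * (x - a)) :=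
      (hh.differentiable (by simp)).differentiableAt.hasDerivAt
    have h3 := (h2.scomp x h1).const_mul ((t : ℂ) ^ n)
    refine h3.congr_deriv ?_
    rw [Complex.real_smul, pow_succ, mul_assoc]

theorem contDiff_integral_pow_mul_comp_segment {h : ℝ → ℂ} (hh : ContDiff ℝ ∞ h) (a : ℝ) (n : ℕ) :
    ContDiff ℝ ∞ fun x => ∫ t in (0 : ℝ)..1, (t : ℂ) ^ n * h (a + t * (x - a)) := by
  rw [contDiff_infty]
  intro m
  induction m generalizing h n with
  | zero =>
    refine contDiff_zero.2 (continuous_iff_continuousAt.2 fun x => ?_)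
    exact (hasDerivAt_integral_pow_mul_comp_segment hh a n x).continuousAt
  | succ m ih =>
    push_cast
    rw [contDiff_succ_iff_deriv]
    refine ⟨fun x => (hasDerivAt_integral_pow_mul_comp_segment hh a n x).differentiableAt,
      by simp, ?_⟩
    have : deriv (fun x => ∫ t in (0 : ℝ)..1, (t : ℂ) ^ n * h (a + t * (x - a))) =
        fun x => ∫ t in (0 : ℝ)..1, (t : ℂ) ^ (n + 1) * deriv h (a + t * (x - a)) :=
      funext fun x => (hasDerivAt_integral_pow_mul_comp_segment hh a n x).deriv
    rw [this]
    exact ih (contDiff_infty_iff_deriv.1 hh).2 (n + 1)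

/-- Hadamard's lemma: the difference quotient of a smooth function is smooth, since it is
`∫₀¹ f' (a + t (x - a)) dt`. -/
theorem contDiff_dslope {f : ℝ → ℂ} (hf : ContDiff ℝ ∞ f) (a : ℝ) : ContDiff ℝ ∞ (dslope f a) := by
  have hd : Continuous (deriv f) := hf.continuous_deriv (by simp)
  have key : dslope f a =
      fun x => ∫ t in (0 : ℝ)..1, (t : ℂ) ^ 0 * deriv f (a + t * (x - a)) := by
    funext x
    rcases eq_or_ne x a with rfl | hx
    · simp [dslope_same]
    · have hx' : x - a ≠ 0 := sub_ne_zero.2 hx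
      have hder : ∀ t ∈ Set.uIcc (0 : ℝ) 1, HasDerivAt (fun t => f (a + t * (x - a)))
          ((x - a) • deriv f (a + t * (x - a))) t := by
        intro t _
        have h1 : HasDerivAt (fun t => a + t * (x - a)) (x - a) t := by
          simpa using ((hasDerivAt_id t).mul_const (x - a)).const_add a
        exact ((hf.differentiable (by simp)).differentiableAt.hasDerivAt.scomp t h1)
      have hint := intervalIntegral.integral_eq_sub_of_hasDerivAt hder
        (Continuous.intervalIntegrable (by fun_prop) _ _)
      rw [intervalIntegral.integral_smul] at hint
      rw [dslope_of_ne _ hx, slope_def_module]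
      simp only [pow_zero, one_mul]
      rw [inv_smul_eq_iff₀ hx', hint]
      simp
  rw [key]
  exact contDiff_integral_pow_mul_comp_segment (contDiff_infty_iff_deriv.1 hf).2 a 0

/-- A smooth function that vanishes wherever `v` does is divisible by `v`, if all zeros of `v` are
simple. -/
theorem exists_smooth_quotient {v f : ℝ → ℂ} (hv : ContDiff ℝ ∞ v) (hf : ContDiff ℝ ∞ f)
    (hsimple : ∀ a, v a = 0 → deriv v a ≠ 0) (hvan : ∀ a, v a = 0 → f a = 0) :
    ∃ g : ℝ → ℂ, ContDiff ℝ ∞ g ∧ (∀ x, f x = v x * g x) ∧ ∀ x, v x ≠ 0 → g x = f x / v x := by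
  classical
  set g : ℝ → ℂ := fun x => if v x = 0 then deriv f x / deriv v x else f x / v x with hg
  refine ⟨g, contDiff_iff_contDiffAt.2 fun a => ?_, fun x => ?_, fun x hx => if_neg hx⟩
  · by_cases ha : v a = 0
    -- Near a zero `a` of `v`, the quotient of the difference quotients at `a` extends `f / v`.
    · have hda : dslope v a a ≠ 0 := by
        rw [dslope_same]
        exact hsimple a ha
      have hne : ∀ᶠ x in nhds a, dslope v a x ≠ 0 :=
        (contDiff_dslope hv a).continuous.continuousAt.eventually_ne hda
      have hq : ContDiffAt ℝ ∞ (fun x => dslope f a x / dslope v a x) a :=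
        by
        simp only [div_eq_mul_inv]
        exact (contDiff_dslope hf a).contDiffAt.mul ((contDiff_dslope hv a).contDiffAt.inv hda)
      refine hq.congr_of_eventuallyEq ?_
      filter_upwards [hne] with x hx
      rcases eq_or_ne x a with rfl | hxa
      · simp only [hg, if_pos ha, dslope_same]
      · have hxa' : ((x - a : ℝ) : ℂ) ≠ 0 := by exact_mod_cast sub_ne_zero.2 hxa
        have hs : ∀ w : ℝ → ℂ, w a = 0 → w x = (x - a : ℝ) * dslope w a x := by
          intro w hw
          have := sub_smul_dslope w a x
          rw [hw, sub_zero, Complex.real_smul] at this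
          exact this.symm
        have hvx : v x ≠ 0 := by
          rw [hs v ha]
          exact mul_ne_zero hxa' hx
        simp only [hg, if_neg hvx]
        rw [hs v ha, hs f (hvan a ha), mul_div_mul_left _ _ hxa']
    · have hne : ∀ᶠ x in nhds a, v x ≠ 0 := hv.continuous.continuousAt.eventually_ne ha
      refine (hf.contDiffAt.mul (hv.contDiffAt.inv ha)).congr_of_eventuallyEq ?_
      filter_upwards [hne] with x hx
      simp only [hg, if_neg hx, div_eq_mul_inv, Pi.inv_apply]
  · by_cases hx : v x = 0
    · rw [hvan x hx, hx, zero_mul]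
    · simp only [hg, if_neg hx]
      rw [mul_div_cancel₀ _ hx]

/-- If `v g` vanishes to order `n + 1` at a simple zero of `v`, then `g` vanishes to order `n`. -/
theorem iteratedDeriv_eq_zero_of_mul {v g : ℝ → ℂ} (hv : ContDiff ℝ ∞ v) (hg : ContDiff ℝ ∞ g)
    {a : ℝ} (ha : v a = 0) (ha' : deriv v a ≠ 0) {n : ℕ}
    (h : ∀ j ≤ n + 1, iteratedDeriv j (fun x => v x * g x) a = 0) :
    ∀ j ≤ n, iteratedDeriv j g a = 0 := by
  intro j
  induction j using Nat.strong_induction_on with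
  | _ j ih =>
    intro hj
    have h0 := h (j + 1) (by omega)
    have hle : (((j + 1 : ℕ) : ℕ∞) : WithTop ℕ∞) ≤ ∞ := mod_cast le_top
    have hL := iteratedDeriv_mul (hv.contDiffAt.of_le hle) (hg.contDiffAt.of_le hle) (x := a)
    have hfun : v * g = fun x => v x * g x := rfl
    -- In the Leibniz rule the term with no derivative on `v` vanishes as `v a = 0`, and those with
    -- at least two vanish by induction, which isolates `(j + 1) v'(a) g⁽ʲ⁾(a)`.
    rw [hfun, h0, Finset.sum_eq_single 1] at hL
    · rw [iteratedDeriv_one, Nat.choose_one_right, Nat.add_sub_cancel] at hL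
      have h1 : (j : ℂ) + 1 ≠ 0 := by exact_mod_cast j.succ_ne_zero
      simpa [ha', h1] using hL
    · intro i hi hi1
      have := Finset.mem_range.1 hi
      rcases Nat.eq_zero_or_pos i with rfl | hipos
      · rw [iteratedDeriv_zero, ha, mul_zero, zero_mul]
      · rw [ih (j + 1 - i) (by omega) (by omega), mul_zero]
    · intro hmem
      exact absurd (Finset.mem_range.2 (by omega)) hmem

/-- The product with the `n`-th power of a function vanishing at `a` vanishes to order `n - 1`. -/
theorem iteratedDeriv_pow_mul_eq_zero {v : ℝ → ℂ} (hv : ContDiff ℝ ∞ v) {a : ℝ} (ha : v a = 0)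
    {n : ℕ} {w : ℝ → ℂ} (hw : ContDiff ℝ ∞ w) {j : ℕ} (hj : j < n) :
    iteratedDeriv j (fun x => v x ^ n * w x) a = 0 := by
  induction j generalizing n w with
  | zero => rw [iteratedDeriv_zero, ha, zero_pow (by omega), zero_mul]
  | succ j ih =>
    obtain ⟨n, rfl⟩ := Nat.exists_eq_add_of_lt hj
    obtain ⟨m, hm⟩ : ∃ m, j + 1 + n + 1 = m + 1 := ⟨j + 1 + n, rfl⟩
    rw [hm, iteratedDeriv_succ']
    have hder : deriv (fun x => v x ^ (m + 1) * w x) =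
        fun x => v x ^ m * ((m + 1) * deriv v x * w x + v x * deriv w x) := by
      funext x
      have h1 : HasDerivAt v (deriv v x) x :=
        (hv.differentiable (by simp)).differentiableAt.hasDerivAt
      have h2 : HasDerivAt w (deriv w x) x :=
        (hw.differentiable (by simp)).differentiableAt.hasDerivAt
      rw [((h1.fun_pow (m + 1)).fun_mul h2).deriv]
      push_cast
      ring
    rw [hder]
    refine ih ?_ (by omega)
    have hv' := (contDiff_infty_iff_deriv.1 hv).2
    have hw' := (contDiff_infty_iff_deriv.1 hw).2
    fun_prop

/-! ### The Fourier transform turns differences into multiplication -/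

/-- The function `exp (-2πix) - 1`, the symbol of the difference operator `f ↦ f (· - 1) - f`. -/
def symb (x : ℝ) : ℂ := Complex.exp (-(2 * Real.pi * Complex.I) * x) - 1

theorem contDiff_symb : ContDiff ℝ ∞ symb :=
  ((contDiff_const.mul Complex.ofRealCLM.contDiff).cexp).sub contDiff_const

theorem hasDerivAt_symb (x : ℝ) : HasDerivAt symb
    (Complex.exp (-(2 * Real.pi * Complex.I) * x) * -(2 * Real.pi * Complex.I)) x := by
  have h := ((Complex.ofRealCLM.hasDerivAt (x := x)).const_mul
    (-(2 * Real.pi * Complex.I))).cexp.sub_const 1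
  exact h.congr_deriv (by simp)

theorem symb_eq_zero_iff (x : ℝ) : symb x = 0 ↔ ∃ k : ℤ, x = k := by
  have hpi : (2 * Real.pi * Complex.I : ℂ) ≠ 0 := Complex.two_pi_I_ne_zero
  rw [symb, sub_eq_zero, Complex.exp_eq_one_iff]
  constructor
  · rintro ⟨n, hn⟩
    refine ⟨-n, ?_⟩
    have : (2 * Real.pi * Complex.I : ℂ) * x = (2 * Real.pi * Complex.I) * ((-n : ℤ) : ℝ) := by
      push_cast
      linear_combination -hn
    exact_mod_cast mul_left_cancel₀ hpi this
  · rintro ⟨k, rfl⟩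
    refine ⟨-k, ?_⟩
    push_cast
    ring

theorem symb_intCast (k : ℤ) : symb k = 0 := (symb_eq_zero_iff _).2 ⟨k, rfl⟩

theorem deriv_symb_ne_zero (x : ℝ) : deriv symb x ≠ 0 := by
  rw [(hasDerivAt_symb x).deriv]
  exact mul_ne_zero (Complex.exp_ne_zero _) (neg_ne_zero.2 Complex.two_pi_I_ne_zero)

open FourierTransform in
/-- Multiplication by `symb` on the Schwartz space, as the Fourier conjugate of the difference
operator. -/
def mulSymb : 𝓢(ℝ, ℂ) →L[ℂ] 𝓢(ℝ, ℂ) :=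
  fourierCLM ℂ 𝓢(ℝ, ℂ) ∘L SchwartzMap.compSubConstCLM ℂ (1 : ℝ) ∘L fourierInvCLM ℂ 𝓢(ℝ, ℂ) -
    ContinuousLinearMap.id ℂ _

open FourierTransform in
theorem mulSymb_apply (f : 𝓢(ℝ, ℂ)) (x : ℝ) : mulSymb f x = symb x * f x := by
  change 𝓕 (SchwartzMap.compSubConstCLM ℂ (1 : ℝ) (𝓕⁻ f)) x - f x = _
  have hshift : 𝓕 (SchwartzMap.compSubConstCLM ℂ (1 : ℝ) (𝓕⁻ f)) x =
      Complex.exp (-(2 * Real.pi * Complex.I) * x) * 𝓕 (𝓕⁻ f) x := by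
    have h := congrFun (VectorFourier.fourierIntegral_comp_add_right Real.fourierChar
      MeasureTheory.volume (innerₗ ℝ) (𝓕⁻ f : 𝓢(ℝ, ℂ)) (-1)) x
    refine Eq.trans h ?_
    rw [Circle.smul_def, Real.fourierChar_apply, smul_eq_mul]
    congr 2
    simp
    ring
  rw [hshift, fourier_fourierInv_eq, symb]
  ring

theorem mulSymb_pow_apply (n : ℕ) (f : 𝓢(ℝ, ℂ)) (x : ℝ) :
    (mulSymb ^ n) f x = symb x ^ n * f x := by
  induction n generalizing f with
  | zero => simp
  | succ n ih =>
    rw [pow_succ]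
    change (mulSymb ^ n) (mulSymb f) x = _
    rw [ih, mulSymb_apply]
    ring

/-- Multiplication of tempered distributions by `symb`. -/
def mulSymbTemp : Temp →ₗ[ℂ] Temp := (PointwiseConvergenceCLM.precomp ℂ mulSymb).toLinearMap

theorem mulSymbTemp_pow_apply (n : ℕ) (T : Temp) (f : 𝓢(ℝ, ℂ)) :
    (mulSymbTemp ^ n) T f = T ((mulSymb ^ n) f) := by
  induction n generalizing T with
  | zero => rfl
  | succ n ih => rw [pow_succ, Module.End.mul_apply, ih, pow_succ']; rfl

open FourierTransform in
theorem fourierTemp_translate_sub (T : Temp) :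
    fourierTemp ((translateTemp (Multiplicative.ofAdd 1) - 1) T) = mulSymbTemp (fourierTemp T) := by
  refine ContinuousLinearMap.ext fun f => ?_
  change T (SchwartzMap.compSubConstCLM ℂ ((1 : ℤ) : ℝ) (𝓕⁻ f)) - T (𝓕⁻ f) =
    T (𝓕⁻ (𝓕 (SchwartzMap.compSubConstCLM ℂ (1 : ℝ) (𝓕⁻ f)) - f))
  rw [Int.cast_one]
  have h : 𝓕⁻ (𝓕 (SchwartzMap.compSubConstCLM ℂ (1 : ℝ) (𝓕⁻ f)) - f) =
      SchwartzMap.compSubConstCLM ℂ (1 : ℝ) (𝓕⁻ f) - 𝓕⁻ f := by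
    have := map_sub (fourierInvCLM ℂ 𝓢(ℝ, ℂ))
      (𝓕 (SchwartzMap.compSubConstCLM ℂ (1 : ℝ) (𝓕⁻ f))) f
    simpa using this
  rw [h, map_sub]

open FourierTransform in
theorem fourierTemp_bijective : Function.Bijective fourierTemp := by
  constructor
  · intro S T h
    refine ContinuousLinearMap.ext fun f => ?_
    have := DFunLike.congr_fun h (𝓕 f)
    change S (𝓕⁻ (𝓕 f)) = T (𝓕⁻ (𝓕 f)) at this
    rwa [fourierInv_fourier_eq] at this
  · intro S
    refine ⟨PointwiseConvergenceCLM.precomp ℂ (fourierCLM ℂ 𝓢(ℝ, ℂ)) S,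
      ContinuousLinearMap.ext fun f => ?_⟩
    change S (𝓕 (𝓕⁻ f)) = S f
    rw [fourier_fourierInv_eq]

/-- A tempered distribution is an invariant of order `q` if and only if its Fourier transform is
annihilated by `symb ^ (q + 1)`. -/
theorem mem_invariants_iff_fourierTemp (q : ℕ) (T : Temp) :
    T ∈ invariants translateTemp q ↔ ∀ f : Test, fourierTemp T (testToSchwartz
      (mulTest (fun x => symb x ^ (q + 1)) (contDiff_symb.pow (q + 1)) f)) = 0 := by
  have hmul : ∀ f : Test, testToSchwartz
      (mulTest (fun x => symb x ^ (q + 1)) (contDiff_symb.pow (q + 1)) f) =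
        (mulSymb ^ (q + 1)) (testToSchwartz f) := fun f =>
    SchwartzMap.ext fun x => (mulSymb_pow_apply (q + 1) (testToSchwartz f) x).symm
  rw [mem_invariants_int, ← map_eq_zero_iff fourierTemp fourierTemp_bijective.1,
    map_pow_apply_of_intertwine fourierTemp _ mulSymbTemp fourierTemp_translate_sub]
  constructor
  · intro h f
    rw [hmul, ← mulSymbTemp_pow_apply, h]
    rfl
  · intro h
    refine tempered_ext fun f => ?_
    rw [mulSymbTemp_pow_apply, ← hmul, h]
    rfl

/-! ### Distributions annihilated by a power of the symbol -/

theorem iterate_distrDeriv_diracDistr (n : ℕ) (x : ℝ) (f : Test) :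
    (distrDeriv^[n] (diracDistr x)) f = (-1) ^ n * iteratedDeriv n f x := by
  induction n generalizing f with
  | zero => simp
  | succ n ih =>
    rw [Function.iterate_succ_apply']
    change -((distrDeriv^[n] (diracDistr x)) (TestFunction.lineDerivCLM ℂ (1 : ℝ) f)) = _
    have hd : ⇑(TestFunction.lineDerivCLM ℂ (1 : ℝ) f : Test) = deriv f := by
      ext y
      rw [TestFunction.lineDerivCLM_apply_of_le (by simp),
        (f.contDiff.differentiable (by simp)).differentiableAt.lineDeriv_eq_fderiv,
        fderiv_apply_one_eq_deriv]
    rw [ih, hd, iteratedDeriv_succ', pow_succ]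
    ring

theorem iterate_distrDeriv_diracDistr_eq_zero_iff (n : ℕ) (x : ℝ) (f : Test) :
    (distrDeriv^[n] (diracDistr x)) f = 0 ↔ iteratedDeriv n f x = 0 := by
  rw [iterate_distrDeriv_diracDistr, mul_eq_zero, or_iff_right (pow_ne_zero n (by norm_num))]

theorem iteratedDeriv_eq_zero_of_notMem_tsupport (n : ℕ) {f : ℝ → ℂ} {x : ℝ}
    (hx : x ∉ tsupport f) : iteratedDeriv n f x = 0 := by
  rw [(notMem_tsupport_iff_eventuallyEq.1 hx).iteratedDeriv_eq n]
  change iteratedDeriv n (fun _ => (0 : ℂ)) x = 0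
  simp

theorem exists_plateau_mul_eq (f : Test) : ∃ χ : Test, ∀ x, χ x * f x = f x := by
  obtain ⟨r, hr⟩ := f.hasCompactSupport.isBounded.exists_norm_le
  obtain ⟨n, hn⟩ := exists_nat_ge r
  have hn0 : (0 : ℝ) < n + 1 := by positivity
  refine ⟨⟨fun x => plateau ((n + 1 : ℝ)⁻¹ * x), contDiff_comp_mul_left plateau.contDiff _,
    plateau.hasCompactSupport.comp_homeomorph
      (Homeomorph.mulLeft₀ (n + 1 : ℝ)⁻¹ (by positivity)), Set.subset_univ _⟩, fun x => ?_⟩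
  change plateau ((n + 1 : ℝ)⁻¹ * x) * f x = f x
  by_cases hx : f x = 0
  · rw [hx, mul_zero]
  · have hxr : |x| ≤ r := hr x (subset_tsupport f hx)
    rw [plateau_eq_one, one_mul]
    rw [abs_mul, abs_inv, abs_of_pos hn0, inv_mul_le_iff₀ hn0, mul_one]
    linarith

/-- A test function vanishing to order `q` at every integer is divisible by `symb ^ (q + 1)`. -/
theorem exists_eq_mulTest_symb_pow (q : ℕ) (f : Test)
    (hf : ∀ (k : ℤ), ∀ j ≤ q, iteratedDeriv j f k = 0) :
    ∃ g : Test, f = mulTest (fun x => symb x ^ (q + 1)) (contDiff_symb.pow (q + 1)) g := by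
  have hdiv : ∀ f : Test, (∀ k : ℤ, f k = 0) → ∃ g : Test, ∀ x, f x = symb x * g x := by
    intro f hf
    obtain ⟨g, hg, hfg, -⟩ := exists_smooth_quotient contDiff_symb f.contDiff
      (fun a _ => deriv_symb_ne_zero a) fun a ha => by
        obtain ⟨k, rfl⟩ := (symb_eq_zero_iff a).1 ha
        exact hf k
    obtain ⟨χ, hχ⟩ := exists_plateau_mul_eq f
    -- The smooth quotient `g` need not be presented with compact support, so it is cut off.
    refine ⟨mulTest g hg χ, fun x => ?_⟩
    rw [mulTest_apply, ← hχ, hfg]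
    ring
  induction q generalizing f with
  | zero =>
    obtain ⟨g, hg⟩ := hdiv f fun k => by simpa using hf k 0 le_rfl
    exact ⟨g, TestFunction.ext fun x => by rw [mulTest_apply, hg, zero_add, pow_one]⟩
  | succ q ih =>
    obtain ⟨g, hg⟩ := hdiv f fun k => by simpa using hf k 0 (Nat.zero_le _)
    have hfun : ⇑f = fun x => symb x * g x := funext hg
    obtain ⟨g', hg'⟩ := ih g fun k => iteratedDeriv_eq_zero_of_mul contDiff_symb g.contDiff
      (symb_intCast k) (deriv_symb_ne_zero k) fun j hj => by
        rw [← hfun]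
        exact hf k j hj
    refine ⟨g', TestFunction.ext fun x => ?_⟩
    rw [hg, hg', mulTest_apply, mulTest_apply, pow_succ _ (q + 1)]
    ring

/-- The localized Taylor monomial `(x - k)ⁿ / n!` at the integer `k`. -/
def taylorTest (n : ℕ) (k : ℤ) : Test :=
  ⟨fun x => plateau (4 * (x - k)) * (((x - k : ℝ) : ℂ) ^ n / n.factorial),
    (plateau.contDiff.comp (contDiff_const.mul (contDiff_id.sub contDiff_const))).mul
      (((Complex.ofRealCLM.contDiff.comp (contDiff_id.sub contDiff_const)).pow n).div_const _),
    (plateau.hasCompactSupport.comp_homeomorph ((Homeomorph.subRight (k : ℝ)).trans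
      (Homeomorph.mulLeft₀ 4 (by norm_num)))).mul_right, Set.subset_univ _⟩

theorem taylorTest_apply (n : ℕ) (k : ℤ) (x : ℝ) : taylorTest n k x =
    plateau (4 * (x - k)) * (((x - k : ℝ) : ℂ) ^ n / n.factorial) := rfl

theorem iteratedDeriv_taylor_monomial (n j : ℕ) (a : ℝ) :
    iteratedDeriv j (fun x : ℝ => ((x - a : ℝ) : ℂ) ^ n / n.factorial) a =
      if j = n then 1 else 0 := by
  induction j generalizing n with
  | zero =>
    rw [iteratedDeriv_zero, sub_self, Complex.ofReal_zero]
    rcases Nat.eq_zero_or_pos n with rfl | hn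
    · simp
    · rw [zero_pow hn.ne', zero_div, if_neg hn.ne]
  | succ j ih =>
    rw [iteratedDeriv_succ']
    cases n with
    | zero =>
      simp
    | succ n =>
      have hder : deriv (fun x : ℝ => ((x - a : ℝ) : ℂ) ^ (n + 1) / (n + 1).factorial) =
          fun x : ℝ => ((x - a : ℝ) : ℂ) ^ n / n.factorial := by
        funext x
        have h1 : HasDerivAt (fun x : ℝ => ((x - a : ℝ) : ℂ)) 1 x := by
          simpa using ((hasDerivAt_id x).sub_const a).ofReal_comp
        rw [((h1.fun_pow (n + 1)).div_const _).deriv, Nat.factorial_succ]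
        have h2 : (n : ℂ) + 1 ≠ 0 := by exact_mod_cast n.succ_ne_zero
        have h3 : (n.factorial : ℂ) ≠ 0 := by exact_mod_cast n.factorial_ne_zero
        push_cast
        field_simp
      rw [hder, ih]
      simp

/-- The jets of `taylorTest n k` at the integers are dual to the functionals `∂ʲ δ_l`. -/
theorem iteratedDeriv_taylorTest (n j : ℕ) (k l : ℤ) :
    iteratedDeriv j (taylorTest n k) l = if l = k ∧ j = n then 1 else 0 := by
  by_cases hlk : l = k
  · subst hlk
    have hev : ⇑(taylorTest n l) =ᶠ[nhds (l : ℝ)]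
        fun x : ℝ => ((x - l : ℝ) : ℂ) ^ n / n.factorial := by
      filter_upwards [Metric.ball_mem_nhds (l : ℝ) (ε := 1 / 4) (by norm_num)] with x hx
      rw [taylorTest_apply, plateau_eq_one, one_mul]
      rw [Metric.mem_ball, Real.dist_eq] at hx
      rw [abs_mul, abs_of_pos (by norm_num : (0 : ℝ) < 4)]
      linarith
    rw [hev.iteratedDeriv_eq j, iteratedDeriv_taylor_monomial]
    simp
  · rw [if_neg fun h => hlk h.1]
    apply iteratedDeriv_eq_zero_of_notMem_tsupport
    rw [notMem_tsupport_iff_eventuallyEq]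
    filter_upwards [Metric.ball_mem_nhds (l : ℝ) (ε := 1 / 2) (by norm_num)] with x hx
    rw [taylorTest_apply, plateau_eq_zero, zero_mul, Pi.zero_apply]
    rw [Metric.mem_ball, Real.dist_eq] at hx
    have h1 : (1 : ℝ) ≤ |(l : ℝ) - k| := by exact_mod_cast Int.one_le_abs (sub_ne_zero.2 hlk)
    have h2 : |(l : ℝ) - k| ≤ |x - k| + |x - l| := by
      calc |(l : ℝ) - k| = |(x - k) - (x - l)| := by ring_nf
        _ ≤ _ := abs_sub _ _
    rw [abs_mul, abs_of_pos (by norm_num : (0 : ℝ) < 4)]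
    linarith

theorem exists_finset_int_notMem_tsupport (f : Test) :
    ∃ F : Finset ℤ, ∀ k ∉ F, (k : ℝ) ∉ tsupport f := by
  obtain ⟨r, hr⟩ := f.hasCompactSupport.isBounded.exists_norm_le
  obtain ⟨n, hn⟩ := exists_nat_ge r
  refine ⟨Finset.Icc (-n : ℤ) n, fun k hk hmem => hk ?_⟩
  have h : |(k : ℝ)| ≤ n := (hr _ hmem).trans hn
  rw [Finset.mem_Icc]
  exact ⟨by exact_mod_cast (abs_le.1 h).1, by exact_mod_cast (abs_le.1 h).2⟩

/-- A distribution annihilated by `symb ^ (q + 1)` is determined by Taylor polynomials of degree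
at most `q` at the integers, which yields its expansion in derivatives of Dirac distributions. -/
theorem exists_hasExpansion (q : ℕ) (S : Distr) (hS : ∀ f : Test,
    S (mulTest (fun x => symb x ^ (q + 1)) (contDiff_symb.pow (q + 1)) f) = 0) :
    ∃ a : ℤ → ℕ →₀ ℂ, HasExpansion S a ∧ ∀ k n, a k n ≠ 0 → n ≤ q := by
  classical
  -- The sign compensates the one in `⟨∂ⁿ δ_k | f⟩ = (-1)ⁿ f⁽ⁿ⁾(k)`.
  set c : ℤ → ℕ → ℂ := fun k n => if n ≤ q then (-1) ^ n * S (taylorTest n k) else 0 with hc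
  have hcq : ∀ k n, c k n ≠ 0 → n ∈ Finset.range (q + 1) := by
    intro k n hn
    by_contra h
    exact hn (if_neg fun h' => h (Finset.mem_range.2 (Nat.lt_succ_of_le h')))
  refine ⟨fun k => Finsupp.onFinset (Finset.range (q + 1)) (c k) (hcq k), fun f => ?_, fun k n hn =>
    Nat.lt_succ_iff.1 (Finset.mem_range.1 (hcq k n hn))⟩
  obtain ⟨F, hF⟩ := exists_finset_int_notMem_tsupport f
  have hterm : ∀ k : ℤ, ((Finsupp.onFinset (Finset.range (q + 1)) (c k) (hcq k)).sum
      fun n c => c * (distrDeriv^[n] (diracDistr k)) f) =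
        ∑ n ∈ Finset.range (q + 1), iteratedDeriv n f k * S (taylorTest n k) := by
    intro k
    rw [Finsupp.onFinset_sum _ fun n => zero_mul _]
    refine Finset.sum_congr rfl fun n hn => ?_
    simp only [hc]
    rw [if_pos (Nat.lt_succ_iff.1 (Finset.mem_range.1 hn)), iterate_distrDeriv_diracDistr]
    have : ((-1 : ℂ) ^ n) * (-1) ^ n = 1 := by rw [← mul_pow]; simp
    linear_combination (S (taylorTest n k) * iteratedDeriv n f k) * this
  simp only [hterm]
  set p : Test := ∑ k ∈ F, ∑ n ∈ Finset.range (q + 1), iteratedDeriv n f k • taylorTest n k with hp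
  -- The remainder of the Taylor expansion vanishes to order `q` at all integers.
  have hrem : ∀ (l : ℤ), ∀ j ≤ q, iteratedDeriv j (f - p) l = 0 := by
    intro l j hj
    rw [← iterate_distrDeriv_diracDistr_eq_zero_iff j l (f - p), map_sub, hp]
    simp only [map_sum, map_smul, iterate_distrDeriv_diracDistr, iteratedDeriv_taylorTest,
      smul_eq_mul]
    rw [sub_eq_zero]
    by_cases hl : l ∈ F
    · rw [Finset.sum_eq_single l, Finset.sum_eq_single j]
      · simp [mul_comm]
      · intro n _ hn
        simp [Ne.symm hn]
      · intro h
        exact absurd (Finset.mem_range.2 (Nat.lt_succ_of_le hj)) h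
      · intro k _ hk
        simp [Ne.symm hk]
      · exact fun h => absurd hl h
    · rw [iteratedDeriv_eq_zero_of_notMem_tsupport j (hF l hl), mul_zero]
      refine (Finset.sum_eq_zero fun k hk => Finset.sum_eq_zero fun n _ => ?_).symm
      have : l ≠ k := fun h => hl (h ▸ hk)
      simp [this]
  obtain ⟨g, hg⟩ := exists_eq_mulTest_symb_pow q (f - p) hrem
  have hSf : S f = ∑ k ∈ F, ∑ n ∈ Finset.range (q + 1),
      iteratedDeriv n f k * S (taylorTest n k) := by
    have h0 : S (f - p) = 0 := by rw [hg, hS]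
    rw [map_sub, sub_eq_zero] at h0
    rw [h0, hp]
    simp only [map_sum, map_smul, smul_eq_mul]
  rw [hSf]
  refine hasSum_sum_of_ne_finset_zero fun k hk => Finset.sum_eq_zero fun n _ => ?_
  rw [iteratedDeriv_eq_zero_of_notMem_tsupport n (hF k hk), zero_mul]

theorem eq_zero_on_mulTest_symb_pow_of_hasExpansion (q : ℕ) (S : Distr) (a : ℤ → ℕ →₀ ℂ)
    (ha : HasExpansion S a) (haq : ∀ k n, a k n ≠ 0 → n ≤ q) (f : Test) :
    S (mulTest (fun x => symb x ^ (q + 1)) (contDiff_symb.pow (q + 1)) f) = 0 := by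
  refine (ha _).unique ?_
  have hzero : ∀ k : ℤ, ((a k).sum fun n c => c * (distrDeriv^[n] (diracDistr k))
      (mulTest (fun x => symb x ^ (q + 1)) (contDiff_symb.pow (q + 1)) f)) = 0 := by
    intro k
    refine Finset.sum_eq_zero fun n hn => ?_
    have hnq := haq k n (Finsupp.mem_support_iff.1 hn)
    refine mul_eq_zero_of_right _ ((iterate_distrDeriv_diracDistr_eq_zero_iff n k _).2 ?_)
    exact iteratedDeriv_pow_mul_eq_zero contDiff_symb (symb_intCast k) f.contDiff
      (Nat.lt_succ_of_le hnq)
  simp only [hzero]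
  exact hasSum_zero

theorem mem_distrSupportedIn_of_symb_pow (q : ℕ) (S : Distr) (hS : ∀ f : Test,
    S (mulTest (fun x => symb x ^ (q + 1)) (contDiff_symb.pow (q + 1)) f) = 0) :
    S ∈ distrSupportedIn intSet := by
  intro f hf
  obtain ⟨g, hg⟩ := exists_eq_mulTest_symb_pow q f fun k j _ =>
    iteratedDeriv_eq_zero_of_notMem_tsupport j fun h => hf h ⟨k, rfl⟩
  rw [hg, hS]

theorem map_fourierTemp_invariants (q : ℕ) :
    (invariants translateTemp q).map fourierTemp = orderFiltration q := by
  ext S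
  rw [Submodule.mem_map]
  constructor
  · rintro ⟨T, hT, rfl⟩
    rw [mem_invariants_iff_fourierTemp] at hT
    exact ⟨mem_distrSupportedIn_of_symb_pow q (tempToDistr (fourierTemp T)) hT,
      exists_hasExpansion q (tempToDistr (fourierTemp T)) hT⟩
  · rintro ⟨-, a, ha, haq⟩
    obtain ⟨T, rfl⟩ := fourierTemp_bijective.2 S
    exact ⟨T, (mem_invariants_iff_fourierTemp q T).2
      (eq_zero_on_mulTest_symb_pow_of_hasExpansion q _ a ha haq), rfl⟩

/-! ### Tempered distributions supported in the integers -/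

/-- Localizing `v ^ m w` to the region `‖v‖ ≲ ε` makes its `j`-th derivative of size `ε ^ (m - 3j)`:
each derivative costs at most a factor `ε⁻²` from the cutoff and one factor of `v`. -/
theorem exists_bound_iteratedDeriv_localized {v : ℝ → ℂ} (hv : ContDiff ℝ ∞ v) (j : ℕ)
    {φ : ℝ → ℂ} (hφ : ContDiff ℝ ∞ φ) (hφc : HasCompactSupport φ)
    {w : ℝ → ℂ} (hw : ContDiff ℝ ∞ w) (hwc : HasCompactSupport w) {m : ℕ} (hm : 3 * j ≤ m) :
    ∃ C, 0 ≤ C ∧ ∀ ε : ℝ, 0 < ε → ε ≤ 1 → ∀ x,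
      ‖iteratedDeriv j (fun y => φ ((ε ^ 2)⁻¹ * ‖v y‖ ^ 2) * (v y ^ m * w y)) x‖ ≤
        C * ε ^ (m - 3 * j) := by
  have hσ : ContDiff ℝ ∞ fun y => ‖v y‖ ^ 2 := hv.norm_sq ℝ
  induction j generalizing φ w m with
  | zero =>
    obtain ⟨A, hA0, hA⟩ := exists_bound_iteratedFDeriv hφ hφc 0
    obtain ⟨B, hB0, hB⟩ := exists_bound_iteratedFDeriv hw hwc 0
    simp only [norm_iteratedFDeriv_zero] at hA hB
    obtain ⟨r, hr⟩ := hφc.isBounded.exists_norm_le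
    set R := |r| + 1 with hR
    have hR1 : 1 ≤ R := by linarith [abs_nonneg r]
    refine ⟨A * (R ^ m * B), by positivity, fun ε hε0 _ x => ?_⟩
    rw [iteratedDeriv_zero]
    by_cases hx : φ ((ε ^ 2)⁻¹ * ‖v x‖ ^ 2) = 0
    · rw [hx, zero_mul, norm_zero]
      positivity
    · have h1 : (ε ^ 2)⁻¹ * ‖v x‖ ^ 2 ≤ R := by
        have := hr _ (subset_tsupport φ hx)
        linarith [le_abs_self r, (Real.norm_eq_abs _ ▸ le_abs_self _ :
          (ε ^ 2)⁻¹ * ‖v x‖ ^ 2 ≤ ‖(ε ^ 2)⁻¹ * ‖v x‖ ^ 2‖)]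
      have h2 : ‖v x‖ ≤ R * ε := by
        rw [inv_mul_le_iff₀ (by positivity)] at h1
        refine abs_le_of_sq_le_sq' ?_ (by positivity) |>.2
        nlinarith [sq_nonneg ε]
      rw [norm_mul, norm_mul, norm_pow]
      calc _ ≤ A * ((R * ε) ^ m * B) := by
            gcongr
            · exact hA _
            · exact hB _
        _ = _ := by rw [mul_pow, mul_zero, Nat.sub_zero]; ring
  | succ j ih =>
    obtain ⟨n, rfl⟩ : ∃ n, m = n + 1 := ⟨m - 1, by omega⟩
    have hφ' := (contDiff_infty_iff_deriv.1 hφ).2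
    have hv' := (contDiff_infty_iff_deriv.1 hv).2
    have hw' := (contDiff_infty_iff_deriv.1 hw).2
    have hσ' := (contDiff_infty_iff_deriv.1 hσ).2
    set σ : ℝ → ℝ := fun y => ‖v y‖ ^ 2 with hσdef
    have hw1 : ContDiff ℝ ∞ fun y => ((deriv σ y : ℝ) : ℂ) * w y :=
      (Complex.ofRealCLM.contDiff.comp hσ').mul hw
    have hw2 : ContDiff ℝ ∞ fun y => (n + 1) * deriv v y * w y + v y * deriv w y :=
      ((contDiff_const.mul hv').mul hw).add (hv.mul hw')
    obtain ⟨C₁, hC₁0, hC₁⟩ := ih hφ' hφc.deriv hw1 hwc.mul_left (m := n + 1) (by omega)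
    obtain ⟨C₂, hC₂0, hC₂⟩ := ih hφ hφc hw2 (hwc.mul_left.add hwc.deriv.mul_left) (m := n)
      (by omega)
    refine ⟨C₁ + C₂, by positivity, fun ε hε0 hε1 x => ?_⟩
    have hcut : ∀ {ψ : ℝ → ℂ}, ContDiff ℝ ∞ ψ → ContDiff ℝ ∞ fun y => ψ ((ε ^ 2)⁻¹ * σ y) :=
      fun hψ => hψ.comp (contDiff_const.mul hσ)
    have hder : deriv (fun y => φ ((ε ^ 2)⁻¹ * σ y) * (v y ^ (n + 1) * w y)) =
        ((ε ^ 2)⁻¹ : ℂ) • (fun y => deriv φ ((ε ^ 2)⁻¹ * σ y) *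
          (v y ^ (n + 1) * (((deriv σ y : ℝ) : ℂ) * w y))) +
        fun y => φ ((ε ^ 2)⁻¹ * σ y) *
          (v y ^ n * ((n + 1) * deriv v y * w y + v y * deriv w y)) := by
      funext y
      have h1 : HasDerivAt v (deriv v y) y :=
        (hv.differentiable (by simp)).differentiableAt.hasDerivAt
      have h2 : HasDerivAt w (deriv w y) y :=
        (hw.differentiable (by simp)).differentiableAt.hasDerivAt
      have h3 : HasDerivAt (fun y => (ε ^ 2)⁻¹ * σ y) ((ε ^ 2)⁻¹ * deriv σ y) y :=
        ((hσ.differentiable (by simp)).differentiableAt.hasDerivAt).const_mul _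
      have h4 : HasDerivAt φ (deriv φ ((ε ^ 2)⁻¹ * σ y)) ((ε ^ 2)⁻¹ * σ y) :=
        (hφ.differentiable (by simp)).differentiableAt.hasDerivAt
      have h5 : HasDerivAt (fun y => φ ((ε ^ 2)⁻¹ * σ y)) _ y := h4.scomp y h3
      rw [(h5.fun_mul ((h1.fun_pow (n + 1)).fun_mul h2)).deriv]
      simp only [Pi.add_apply, Pi.smul_apply, smul_eq_mul, Complex.real_smul]
      push_cast
      ring
    have hj : ((j : ℕ∞) : WithTop ℕ∞) ≤ ∞ := mod_cast le_top
    have hs1 : ContDiff ℝ ∞ fun y => deriv φ ((ε ^ 2)⁻¹ * σ y) *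
        (v y ^ (n + 1) * (((deriv σ y : ℝ) : ℂ) * w y)) := (hcut hφ').mul ((hv.pow _).mul hw1)
    have hs2 : ContDiff ℝ ∞ fun y => φ ((ε ^ 2)⁻¹ * σ y) *
        (v y ^ n * ((n + 1) * deriv v y * w y + v y * deriv w y)) :=
      (hcut hφ).mul ((hv.pow _).mul hw2)
    have hs3 : ContDiff ℝ ∞ (((ε ^ 2)⁻¹ : ℂ) • fun y => deriv φ ((ε ^ 2)⁻¹ * σ y) *
        (v y ^ (n + 1) * (((deriv σ y : ℝ) : ℂ) * w y))) := contDiff_const.mul hs1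
    rw [iteratedDeriv_succ', hder, iteratedDeriv_add (hs3.contDiffAt.of_le hj)
        (hs2.contDiffAt.of_le hj),
      iteratedDeriv_const_smul (hs1.contDiffAt.of_le hj)]
    obtain ⟨d, hd⟩ : ∃ d, n + 1 = 3 * (j + 1) + d := ⟨n + 1 - 3 * (j + 1), by omega⟩
    have e0 : n + 1 - 3 * (j + 1) = d := by omega
    have e1 : n + 1 - 3 * j = d + 3 := by omega
    have e2 : n - 3 * j = d + 2 := by omega
    have b1 := hC₁ ε hε0 hε1 x
    have b2 := hC₂ ε hε0 hε1 x
    rw [e1] at b1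
    rw [e2] at b2
    rw [e0]
    have hnorm : ‖((ε : ℂ) ^ 2)⁻¹‖ = (ε ^ 2)⁻¹ := by
      rw [norm_inv, norm_pow, Complex.norm_real, Real.norm_of_nonneg hε0.le]
    have hε1d : ε ^ (d + 1) ≤ ε ^ d := pow_le_pow_of_le_one hε0.le hε1 (by omega)
    have hε2d : ε ^ (d + 2) ≤ ε ^ d := pow_le_pow_of_le_one hε0.le hε1 (by omega)
    refine (norm_add_le _ _).trans ?_
    rw [norm_smul, hnorm, add_mul]
    refine add_le_add ?_ (b2.trans (by gcongr))
    calc _ ≤ (ε ^ 2)⁻¹ * (C₁ * ε ^ (d + 3)) := by gcongr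
      _ = C₁ * ε ^ (d + 1) := by
          field_simp
          ring
      _ ≤ C₁ * ε ^ d := by gcongr

/-- The part of `symb ^ m f` close to the integers: a smooth cutoff to the region where `|symb|` is
at most of the order of `ε`. -/
def nearIntegers (m : ℕ) (f : Test) (ε : ℝ) : Test :=
  mulTest (fun y => plateau ((ε ^ 2)⁻¹ * ‖symb y‖ ^ 2))
    (plateau.contDiff.comp (contDiff_const.mul (contDiff_symb.norm_sq ℝ)))
    (mulTest (fun x => symb x ^ m) (contDiff_symb.pow m) f)

theorem apply_nearIntegers {S : Distr} (hS : S ∈ distrSupportedIn intSet) (m : ℕ) (f : Test)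
    {ε : ℝ} (hε : 0 < ε) :
    S (mulTest (fun x => symb x ^ m) (contDiff_symb.pow m) f) = S (nearIntegers m f ε) := by
  rw [← sub_eq_zero, ← map_sub]
  refine hS _ fun x hx hmem => ?_
  obtain ⟨k, rfl⟩ := hmem
  refine notMem_tsupport_iff_eventuallyEq.2 ?_ hx
  have hlim : ∀ᶠ y in nhds (k : ℝ), ‖symb y‖ < ε := by
    refine (contDiff_symb.continuous.norm.continuousAt).eventually_lt continuousAt_const ?_
    rw [symb_intCast, norm_zero]
    exact hε
  filter_upwards [hlim] with y hy
  change symb y ^ m * f y - plateau ((ε ^ 2)⁻¹ * ‖symb y‖ ^ 2) * (symb y ^ m * f y) = 0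
  rw [plateau_eq_one, one_mul, sub_self]
  rw [abs_of_nonneg (by positivity), inv_mul_le_iff₀ (by positivity), mul_one]
  exact pow_le_pow_left₀ (norm_nonneg _) hy.le 2

theorem exists_bound_seminorm_nearIntegers (a : ℕ) {b m : ℕ} (hm : 3 * b + 1 ≤ m) (f : Test) :
    ∃ C, 0 ≤ C ∧ ∀ ε : ℝ, 0 < ε → ε ≤ 1 →
      SchwartzMap.seminorm ℂ a b (testToSchwartz (nearIntegers m f ε)) ≤ C * ε := by
  obtain ⟨C, hC0, hC⟩ := exists_bound_iteratedDeriv_localized contDiff_symb b plateau.contDiff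
    plateau.hasCompactSupport f.contDiff f.hasCompactSupport (m := m) (by omega)
  obtain ⟨r, hr⟩ := f.hasCompactSupport.isBounded.exists_norm_le
  refine ⟨|r| ^ a * C, by positivity, fun ε hε0 hε1 => ?_⟩
  refine SchwartzMap.seminorm_le_bound ℂ a b _ (by positivity) fun x => ?_
  rw [norm_iteratedFDeriv_eq_norm_iteratedDeriv]
  change ‖x‖ ^ a * ‖iteratedDeriv b
    (fun y => plateau ((ε ^ 2)⁻¹ * ‖symb y‖ ^ 2) * (symb y ^ m * f y)) x‖ ≤ _
  by_cases hx : x ∈ tsupport f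
  · have h1 : ‖x‖ ≤ |r| := (hr x hx).trans (le_abs_self r)
    have h2 : ε ^ (m - 3 * b) ≤ ε := by
      simpa using pow_le_pow_of_le_one hε0.le hε1 (show 1 ≤ m - 3 * b by omega)
    calc _ ≤ |r| ^ a * (C * ε ^ (m - 3 * b)) := by
          gcongr
          exact hC ε hε0 hε1 x
      _ ≤ |r| ^ a * (C * ε) := by gcongr
      _ = _ := by ring
  · have hzero : iteratedDeriv b
        (fun y => plateau ((ε ^ 2)⁻¹ * ‖symb y‖ ^ 2) * (symb y ^ m * f y)) x = 0 := by
      refine iteratedDeriv_eq_zero_of_notMem_tsupport b fun h => hx ?_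
      exact (tsupport_mul_subset_right.trans tsupport_mul_subset_right) h
    rw [hzero, norm_zero, mul_zero]
    positivity

/-- A tempered distribution supported in the integers has finite order, hence is annihilated by a
power of `symb`. -/
theorem exists_symb_pow_eq_zero {S : Temp} (hS : S ∈ tempInt) : ∃ q : ℕ, ∀ f : Test,
    S (testToSchwartz (mulTest (fun x => symb x ^ (q + 1)) (contDiff_symb.pow (q + 1)) f)) = 0 := by
  let L : 𝓢(ℝ, ℂ) →L[ℂ] ℂ := S
  obtain ⟨t, C, -, hC⟩ := Seminorm.bound_of_continuous (schwartz_withSeminorms ℂ ℝ ℂ)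
    ((normSeminorm ℂ ℂ).comp L.toLinearMap) (continuous_norm.comp L.continuous)
  -- The order of `S` is at most `N = t.sup Prod.snd`, and the exponent
  -- `3 N + 1` leaves a factor `ε`.
  refine ⟨3 * t.sup Prod.snd, fun f => ?_⟩
  set m := 3 * t.sup Prod.snd + 1 with hm
  have hB : ∀ i : ℕ × ℕ, ∃ B, 0 ≤ B ∧ (i ∈ t → ∀ ε : ℝ, 0 < ε → ε ≤ 1 →
      SchwartzMap.seminorm ℂ i.1 i.2 (testToSchwartz (nearIntegers m f ε)) ≤ B * ε) := by
    intro i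
    by_cases hi : i ∈ t
    · have hle : i.2 ≤ t.sup Prod.snd := Finset.le_sup (f := Prod.snd) hi
      obtain ⟨B, hB0, hB⟩ := exists_bound_seminorm_nearIntegers i.1 (b := i.2) (m := m)
        (by omega) f
      exact ⟨B, hB0, fun _ => hB⟩
    · exact ⟨0, le_rfl, fun h => absurd h hi⟩
  choose B hB0 hB using hB
  set D := ∑ i ∈ t, B i with hD
  have hbound : ∀ ε : ℝ, 0 < ε → ε ≤ 1 →
      ‖S (testToSchwartz (mulTest (fun x => symb x ^ m) (contDiff_symb.pow m) f))‖ ≤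
        C * (D * ε) := by
    intro ε hε0 hε1
    have heq : S (testToSchwartz (mulTest (fun x => symb x ^ m) (contDiff_symb.pow m) f)) =
        S (testToSchwartz (nearIntegers m f ε)) :=
      apply_nearIntegers (S := tempToDistr S) hS m f hε0
    rw [heq]
    have hsup : t.sup (schwartzSeminormFamily ℂ ℝ ℂ) (testToSchwartz (nearIntegers m f ε)) ≤
        D * ε := by
      refine Seminorm.finset_sup_apply_le
        (mul_nonneg (Finset.sum_nonneg fun i _ => hB0 i) hε0.le) fun i hi => ?_
      refine (hB i hi ε hε0 hε1).trans ?_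
      gcongr
      exact Finset.single_le_sum (fun i _ => hB0 i) hi
    calc _ ≤ C * t.sup (schwartzSeminormFamily ℂ ℝ ℂ) (testToSchwartz (nearIntegers m f ε)) :=
          hC _
      _ ≤ C * (D * ε) := by gcongr
  have hlim : Filter.Tendsto (fun n : ℕ => (C : ℝ) * (D * (1 / ((n : ℝ) + 1)))) Filter.atTop
      (nhds 0) := by
    simpa using (tendsto_one_div_add_atTop_nhds_zero_nat.const_mul D).const_mul (C : ℝ)
  rw [← norm_le_zero_iff]
  refine ge_of_tendsto' hlim fun n => hbound _ (by positivity) ?_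
  rw [div_le_one (by positivity)]
  linarith [n.cast_nonneg (α := ℝ)]

theorem mem_invariantsTop_iff_fourierTemp (T : Temp) :
    T ∈ invariantsTop translateTemp ↔ fourierTemp T ∈ tempInt := by
  have hiff : T ∈ invariantsTop translateTemp ↔ ∃ q, T ∈ invariants translateTemp q :=
    Set.mem_iUnion
  rw [hiff]
  constructor
  · rintro ⟨q, hT⟩
    rw [mem_invariants_iff_fourierTemp] at hT
    exact mem_distrSupportedIn_of_symb_pow q (tempToDistr (fourierTemp T)) hT
  · intro h
    obtain ⟨q, hq⟩ := exists_symb_pow_eq_zero h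
    exact ⟨q, (mem_invariants_iff_fourierTemp q T).2 hq⟩

/-- The Fourier transform as a linear bijection from the higher order invariants onto the tempered
distributions supported in the integers. -/
def fourierInvariantsEquiv : invariantsTop translateTemp ≃ₗ[ℂ] tempInt :=
  LinearEquiv.ofBijective
    (fourierTemp.restrict fun T hT => (mem_invariantsTop_iff_fourierTemp T).1 hT)
    ⟨fun _ _ h => Subtype.ext (fourierTemp_bijective.1 (congrArg Subtype.val h)), fun S => by
      obtain ⟨T, hT⟩ := fourierTemp_bijective.2 S
      exact ⟨⟨T, (mem_invariantsTop_iff_fourierTemp T).2 (hT ▸ S.2)⟩, Subtype.ext hT⟩⟩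

end HigherOrder

end

open HigherOrder in
/-- Restriction embeds `𝓢'` into `𝓓'` and identifies `H_q^0(ℤ, 𝓢')` with `H_q^0(ℤ, 𝓓')` for
every `q`; the Fourier transform is a linear bijection from `H_∞^0(ℤ, 𝓢')` onto `𝓢'_ℤ`, and it maps
`H_q^0(ℤ, 𝓢')` onto `O^q 𝓢'_ℤ` for every `q`. -/
theorem theorem2p3 :
    (Function.Injective tempToDistr ∧
      ∀ q : ℕ, (invariants translateTemp q).map tempToDistr = invariants translateDistr q) ∧
    (∃ e : invariantsTop translateTemp ≃ₗ[ℂ] tempInt,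
      ∀ T : invariantsTop translateTemp, (e T : Temp) = fourierTemp (T : Temp)) ∧
    (∀ q : ℕ, (invariants translateTemp q).map fourierTemp = orderFiltration q) :=
  ⟨⟨tempToDistr_injective, map_tempToDistr_invariants⟩, ⟨fourierInvariantsEquiv, fun _ => rfl⟩,
    map_fourierTemp_invariants⟩
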